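/- Let $V$ be a finite-dimensional real vector space with a nondegenerate symmetric bilinear form $\eta$ (of any signature) and a linear operator $J$ with $J^2=-1$ and $\eta(Jv,Ju)=\eta(v,u)$. Let $\mathrm{Cl}(V)$ be the Clifford algebra generated by $V$ with relations $vv'+v'v=\eta(v,v')$, let $\mathrm{Cl}^p(V)\subset \mathrm{Cl}(V)$ be the subspace corresponding to $\Lambda^p(V)$ under the canonical linear isomorphism $\mathrm{Cl}(V)\cong\Lambda(V)$ (so $\mathrm{Cl}^1(V)=V$), and let $V^{\mathbb C}=V\otimes\mathbb C$. Let $M$ be a smooth manifold with a vielbein, i.e. a smooth $1$-form $\theta^{\mathbb R}$ on $M$ with values in $V=\mathrm{Cl}^1(V)$ that restricts to an isomorphism $T_xM\to V$ at every $x\in M$; through it $\eta$ and $J$ induce a (pseudo-)Riemannian metric and an almost complex structure on $M$. Let $\theta=\tfrac12(1-iJ)\theta^{\mathbb R}$ and $\bar\theta=\tfrac12(1+iJ)\theta^{\mathbb R}$ be the components of $\theta^{\mathbb R}$ in the $\pm i$-eigenspaces of $J$ in $V^{\mathbb C}$, regarded as $\mathrm{Cl}(V^{\mathbb C})$-valued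 $1$-forms. Assume that the almost complex structure is integrable, i.e. that the component of type $(0,2)$ of $d\theta$ vanishes. $\mathrm{Cl}$-valued forms are multiplied using the Clifford product of the values and the wedge product of the forms. A metric connection is given by a smooth $1$-form $\omega$ on $M$ with values in $\mathrm{Cl}^2(V)$; it acts on functions $e:M\to V$ by $\nabla e=de+\omega e-e\omega$, and thus, through $\theta^{\mathbb R}$, on vector fields. It preserves the metric, $d\,\eta(e,f)=\eta(\nabla e,f)+\eta(e,\nabla f)$; it preserves the complex structure if $\nabla (Je)=J\nabla e$ for all smooth $e$; and it is torsion-free if $t=d\theta^{\mathbb R}+\omega\theta^{\mathbb R}+\theta^{\mathbb R}\omega=0$. Then a torsion-free connection preserving the metric and the complex structure exists if and only if the scalar-valued $(1,1)$-form $w=\theta\bar\theta-\bar\theta\theta$ is closed. In this case such a connection is unique. -/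

import Mathlib

open scoped Manifold ContDiff TensorProduct

noncomputable section

namespace CliffordForms

/-! ### Clifford algebras -/

section Algebra

variable {V : Type*} [AddCommGroup V] [Module ℝ V]

/-- The quadratic form `v ↦ η(v, v) / 2`. Its Clifford algebra is generated by `V` with the
relations `v v' + v' v = η(v, v')` (for symmetric `η`). -/
def halfForm (η : LinearMap.BilinForm ℝ V) : QuadraticForm ℝ V :=
  (1 / 2 : ℝ) • η.toQuadraticMap

/-- The real Clifford algebra `Cl(V)` of `(V, η)`. -/
abbrev Cl (η : LinearMap.BilinForm ℝ V) : Type _ := CliffordAlgebra (halfForm η)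

/-- The Clifford algebra `Cl(V^ℂ)` of the complexification `V^ℂ = ℂ ⊗ V` with the
complex-bilinear extension of `η`. -/
abbrev ClC (η : LinearMap.BilinForm ℝ V) : Type _ :=
  CliffordAlgebra ((halfForm η).baseChange ℂ)

/-- The inclusion `V → Cl(V)`, with image `Cl¹(V)`. -/
def inclR (η : LinearMap.BilinForm ℝ V) : V →ₗ[ℝ] Cl η := CliffordAlgebra.ι (halfForm η)

/-- The inclusion `V^ℂ → Cl(V^ℂ)`, as a real linear map. -/
def inclC (η : LinearMap.BilinForm ℝ V) : ℂ ⊗[ℝ] V →ₗ[ℝ] ClC η :=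
  (CliffordAlgebra.ι ((halfForm η).baseChange ℂ)).restrictScalars ℝ

/-- The subspace `Clᵖ(V)` of the Clifford algebra corresponding to `Λᵖ(V)` under the canonical
linear isomorphism between `Cl(V)` and `Λ(V)`. -/
def clGrade (η : LinearMap.BilinForm ℝ V) (p : ℕ) : Submodule ℝ (Cl η) :=
  (⋀[ℝ]^p V).comap (CliffordAlgebra.equivExterior (halfForm η)).toLinearMap

/-- The projection of `Cl(V)` on `Cl¹(V) = V` along the other components `Clᵖ(V)`. -/
def proj₁ (η : LinearMap.BilinForm ℝ V) : Cl η →ₗ[ℝ] V :=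
  ExteriorAlgebra.ιInv ∘ₗ (CliffordAlgebra.equivExterior (halfForm η)).toLinearMap

/-- The projection `v ↦ (v - i J v) / 2` of `V` to the `i`-eigenspace of `J` in `V^ℂ`. -/
def holPart (J : V →ₗ[ℝ] V) : V →ₗ[ℝ] ℂ ⊗[ℝ] V :=
  TensorProduct.mk ℝ ℂ V (1 / 2) - (TensorProduct.mk ℝ ℂ V (Complex.I / 2)) ∘ₗ J

/-- The projection `v ↦ (v + i J v) / 2` of `V` to the `(-i)`-eigenspace of `J` in `V^ℂ`. -/
def antiholPart (J : V →ₗ[ℝ] V) : V →ₗ[ℝ] ℂ ⊗[ℝ] V :=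
  TensorProduct.mk ℝ ℂ V (1 / 2) + (TensorProduct.mk ℝ ℂ V (Complex.I / 2)) ∘ₗ J

end Algebra

section Finite

variable {K W : Type*} [Field K] [AddCommGroup W] [Module K W] [FiniteDimensional K W]

theorem finite_exteriorAlgebra : Module.Finite K (ExteriorAlgebra K W) :=
  Module.Finite.of_basis (Module.finBasis K W).ExteriorAlgebra

theorem finite_cliffordAlgebra [Invertible (2 : K)] (Q : QuadraticForm K W) :
    Module.Finite K (CliffordAlgebra Q) :=
  haveI := finite_exteriorAlgebra (K := K) (W := W)
  Module.Finite.equiv (CliffordAlgebra.equivExterior Q).symm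

/-- A norm on a finite-dimensional real vector space (the sup norm of the coordinates in some
basis). Only its topology is used, which does not depend on the basis. -/
abbrev coordNorm (W : Type*) [AddCommGroup W] [Module ℝ W] [FiniteDimensional ℝ W] :
    NormedAddCommGroup W :=
  NormedAddCommGroup.induced W (Fin (Module.finrank ℝ W) → ℝ)
    (Module.finBasis ℝ W).equivFun.toLinearMap (Module.finBasis ℝ W).equivFun.injective

end Finite

section Norms

variable {V : Type*} [AddCommGroup V] [Module ℝ V] [FiniteDimensional ℝ V]

instance instFiniteCl (η : LinearMap.BilinForm ℝ V) : FiniteDimensional ℝ (Cl η) :=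
  finite_cliffordAlgebra (halfForm η)

instance instFiniteClC (η : LinearMap.BilinForm ℝ V) : FiniteDimensional ℝ (ClC η) :=
  haveI : FiniteDimensional ℂ (ClC η) := finite_cliffordAlgebra ((halfForm η).baseChange ℂ)
  Module.Finite.trans ℂ (ClC η)

instance instNormedAddCommGroupCl (η : LinearMap.BilinForm ℝ V) : NormedAddCommGroup (Cl η) :=
  coordNorm (Cl η)

instance instNormedSpaceCl (η : LinearMap.BilinForm ℝ V) : NormedSpace ℝ (Cl η) :=
  NormedSpace.induced ℝ (Cl η) (Fin (Module.finrank ℝ (Cl η)) → ℝ)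
    (Module.finBasis ℝ (Cl η)).equivFun.toLinearMap

instance instNormedAddCommGroupClC (η : LinearMap.BilinForm ℝ V) : NormedAddCommGroup (ClC η) :=
  coordNorm (ClC η)

instance instNormedSpaceClC (η : LinearMap.BilinForm ℝ V) : NormedSpace ℝ (ClC η) :=
  NormedSpace.induced ℝ (ClC η) (Fin (Module.finrank ℝ (ClC η)) → ℝ)
    (Module.finBasis ℝ (ClC η)).equivFun.toLinearMap

end Norms

/-! ### Differential forms on a manifold -/

section Forms

variable {E : Type*} [NormedAddCommGroup E] [NormedSpace ℝ E]
  {M : Type*} [TopologicalSpace M] [ChartedSpace E M]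

variable (E M) in
/-- Differential `k`-forms on `M` with values in the vector space `F` (no regularity). -/
abbrev DForm (F : Type*) [NormedAddCommGroup F] [NormedSpace ℝ F] (k : ℕ) : Type _ :=
  Π x : M, TangentSpace 𝓘(ℝ, E) x [⋀^Fin k]→L[ℝ] F

variable {F : Type*} [NormedAddCommGroup F] [NormedSpace ℝ F] {k : ℕ}

/-- The expression of a form in the preferred chart at `x₀` (its pull-back by the inverse of the
chart); it is meaningful on the target of the chart. -/
def DForm.inChart (α : DForm E M F k) (x₀ : M) (y : E) : E [⋀^Fin k]→L[ℝ] F :=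
  (α ((extChartAt 𝓘(ℝ, E) x₀).symm y)).compContinuousLinearMap
    (mfderiv 𝓘(ℝ, E) 𝓘(ℝ, E) (extChartAt 𝓘(ℝ, E) x₀).symm y)

/-- A form is smooth if its expressions in the charts are smooth. -/
def DForm.IsSmooth (α : DForm E M F k) : Prop :=
  ∀ x₀ : M, ContDiffOn ℝ ∞ (α.inChart x₀) (extChartAt 𝓘(ℝ, E) x₀).target

/-- The exterior derivative, computed at `x` in the preferred chart at `x`. -/
def DForm.d (α : DForm E M F k) : DForm E M F (k + 1) := fun x =>
  (extDeriv (α.inChart x) (extChartAt 𝓘(ℝ, E) x x)).compContinuousLinearMap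
    (mfderiv 𝓘(ℝ, E) 𝓘(ℝ, E) (extChartAt 𝓘(ℝ, E) x) x)

/-- A family of linear maps `T_x M → F`, seen as a form of degree one. -/
def DForm.ofLinear (f : Π x : M, TangentSpace 𝓘(ℝ, E) x →L[ℝ] F) : DForm E M F 1 := fun x =>
  ContinuousAlternatingMap.ofSubsingleton ℝ (TangentSpace 𝓘(ℝ, E) x) F (0 : Fin 1) (f x)

/-- A one-form evaluated at a tangent vector. -/
def DForm.at₁ (α : DForm E M F 1) (x : M) (X : TangentSpace 𝓘(ℝ, E) x) : F := α x ![X]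

/-- The tensor product `(X, Y) ↦ B(α(X), β(Y))` of two one-forms at a point, with respect to a
bilinear map `B` on their values. -/
def DForm.tensor₁ {G : Type*} [NormedAddCommGroup G] [NormedSpace ℝ G] (B : F →L[ℝ] F →L[ℝ] G)
    (α β : DForm E M F 1) (x : M) :
    ContinuousMultilinearMap ℝ (fun _ : Fin 2 => TangentSpace 𝓘(ℝ, E) x) G where
  toFun := fun v => B (α x fun _ => v 0) (β x fun _ => v 1)
  map_update_add' := by
    intro inst v i X Y
    obtain rfl := Subsingleton.elim inst (instDecidableEqFin 2)
    have hα := ((ContinuousAlternatingMap.ofSubsingleton ℝ _ F (0 : Fin 1)).symm (α x)).map_add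
    have hβ := ((ContinuousAlternatingMap.ofSubsingleton ℝ _ F (0 : Fin 1)).symm (β x)).map_add
    fin_cases i
    · exact (congrArg (fun f => B f _) (hα X Y)).trans (by simp)
    · exact (congrArg (fun f => B _ f) (hβ X Y)).trans (by simp)
  map_update_smul' := by
    intro inst v i c X
    obtain rfl := Subsingleton.elim inst (instDecidableEqFin 2)
    have hα :=
      ((ContinuousAlternatingMap.ofSubsingleton ℝ _ F (0 : Fin 1)).symm (α x)).map_smul
    have hβ :=
      ((ContinuousAlternatingMap.ofSubsingleton ℝ _ F (0 : Fin 1)).symm (β x)).map_smul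
    fin_cases i
    · exact (congrArg (fun f => B f _) (hα c X)).trans (by simp)
    · exact (congrArg (fun f => B _ f) (hβ c X)).trans (by simp)
  cont := by
    have hα : Continuous fun v : Fin 2 → TangentSpace 𝓘(ℝ, E) x => α x fun _ => v 0 :=
      (α x).cont.comp (continuous_pi fun _ => continuous_apply 0)
    have hβ : Continuous fun v : Fin 2 → TangentSpace 𝓘(ℝ, E) x => β x fun _ => v 1 :=
      (β x).cont.comp (continuous_pi fun _ => continuous_apply 1)
    exact (B.continuous.comp hα).clm_apply hβ

/-- The product of two one-forms with respect to a bilinear map `B` on their values,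
`(X, Y) ↦ B(α(X), β(Y)) - B(α(Y), β(X))`. -/
def DForm.wedge₁ {G : Type*} [NormedAddCommGroup G] [NormedSpace ℝ G] (B : F →L[ℝ] F →L[ℝ] G)
    (α β : DForm E M F 1) : DForm E M G 2 := fun x =>
  ContinuousMultilinearMap.alternatization (α.tensor₁ B β x)

theorem DForm.wedge₁_apply {G : Type*} [NormedAddCommGroup G] [NormedSpace ℝ G]
    (B : F →L[ℝ] F →L[ℝ] G) (α β : DForm E M F 1) (x : M) (X Y : TangentSpace 𝓘(ℝ, E) x) :
    α.wedge₁ B β x ![X, Y] = B (α.at₁ x X) (β.at₁ x Y) - B (α.at₁ x Y) (β.at₁ x X) := by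
  have h : ∀ Z : TangentSpace 𝓘(ℝ, E) x, (![Z] : Fin 1 → _) = fun _ => Z := fun Z => by
    ext i; simp
  have ht : ∀ v : Fin 2 → TangentSpace 𝓘(ℝ, E) x,
      α.tensor₁ B β x v = B (α.at₁ x (v 0)) (β.at₁ x (v 1)) := fun v => by
    simp only [DForm.at₁, h]; rfl
  have hu : (Finset.univ : Finset (Equiv.Perm (Fin 2))) = {1, Equiv.swap 0 1} := by decide
  rw [DForm.wedge₁, ContinuousMultilinearMap.alternatization_apply_apply, hu,
    Finset.sum_pair (by decide)]
  simp [ht, sub_eq_add_neg]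

end Forms

/-! ### Vielbein, connection, torsion and the complex structure -/

section Clifford

variable {E : Type*} [NormedAddCommGroup E] [NormedSpace ℝ E]
  {M : Type*} [TopologicalSpace M] [ChartedSpace E M]
  {V : Type*} [NormedAddCommGroup V] [NormedSpace ℝ V] [FiniteDimensional ℝ V]

/-- The product of one-forms with values in `Cl(V)`: `(α β)(X, Y) = α(X) β(Y) - α(Y) β(X)`. -/
def mulR (η : LinearMap.BilinForm ℝ V) (α β : DForm E M (Cl η) 1) : DForm E M (Cl η) 2 :=
  α.wedge₁ (LinearMap.mul ℝ (Cl η)).toContinuousBilinearMap β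

/-- The product of one-forms with values in `Cl(V^ℂ)`:
`(α β)(X, Y) = α(X) β(Y) - α(Y) β(X)`. -/
def mulC (η : LinearMap.BilinForm ℝ V) (α β : DForm E M (ClC η) 1) : DForm E M (ClC η) 2 :=
  α.wedge₁ (LinearMap.mul ℝ (ClC η)).toContinuousBilinearMap β

variable (E M) in
/-- A family of linear isomorphisms from the tangent spaces of `M` to `V`. -/
abbrev Frame (V : Type*) [NormedAddCommGroup V] [NormedSpace ℝ V] : Type _ :=
  Π x : M, TangentSpace 𝓘(ℝ, E) x ≃L[ℝ] V

/-- The one-form with values in `F` obtained from a frame and a linear map `V → F`. -/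
def Frame.form {F : Type*} [NormedAddCommGroup F] [NormedSpace ℝ F] (θ : Frame E M V)
    (L : V →ₗ[ℝ] F) : DForm E M F 1 :=
  DForm.ofLinear fun x => L.toContinuousLinearMap ∘L (θ x : TangentSpace 𝓘(ℝ, E) x →L[ℝ] V)

/-- The real vielbein `θ^ℝ`, as a one-form with values in `Cl¹(V)`. -/
def thetaR (η : LinearMap.BilinForm ℝ V) (θ : Frame E M V) : DForm E M (Cl η) 1 :=
  θ.form (inclR η)

/-- The component `θ` of the vielbein in the `i`-eigenspace of `J`, as a one-form with values in
`Cl¹(V^ℂ)`. -/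
def theta (η : LinearMap.BilinForm ℝ V) (J : V →ₗ[ℝ] V) (θ : Frame E M V) :
    DForm E M (ClC η) 1 :=
  θ.form (inclC η ∘ₗ holPart J)

/-- The component `θ̄` of the vielbein in the `(-i)`-eigenspace of `J`, as a one-form with values
in `Cl¹(V^ℂ)`. -/
def thetaBar (η : LinearMap.BilinForm ℝ V) (J : V →ₗ[ℝ] V) (θ : Frame E M V) :
    DForm E M (ClC η) 1 :=
  θ.form (inclC η ∘ₗ antiholPart J)

/-- The form `w = θ θ̄ - θ̄ θ`. -/
def kahlerForm (η : LinearMap.BilinForm ℝ V) (J : V →ₗ[ℝ] V) (θ : Frame E M V) :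
    DForm E M (ClC η) 2 :=
  mulC η (theta η J θ) (thetaBar η J θ) - mulC η (thetaBar η J θ) (theta η J θ)

/-- The almost complex structure on `M` induced by `J` and the frame. -/
def Frame.tangentJ (θ : Frame E M V) (J : V →ₗ[ℝ] V) (x : M) (X : TangentSpace 𝓘(ℝ, E) x) :
    TangentSpace 𝓘(ℝ, E) x :=
  (θ x).symm (J (θ x X))

/-- The component of type `(0, 2)` of a `Cl(V^ℂ)`-valued two-form `φ` with respect to the induced
almost complex structure: the value of the complex-bilinear extension of `φ` at
`(X + i J X) / 2` and `(Y + i J Y) / 2`. -/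
def comp02 (η : LinearMap.BilinForm ℝ V) (J : V →ₗ[ℝ] V) (θ : Frame E M V)
    (φ : DForm E M (ClC η) 2) (x : M) (X Y : TangentSpace 𝓘(ℝ, E) x) : ClC η :=
  (1 / 4 : ℂ) • (φ x ![X, Y] + Complex.I • φ x ![θ.tangentJ J x X, Y]
    + Complex.I • φ x ![X, θ.tangentJ J x Y] - φ x ![θ.tangentJ J x X, θ.tangentJ J x Y])

/-- Integrability of the induced almost complex structure: the component of type `(0, 2)` of `dθ`
vanishes. -/
def IsIntegrable (η : LinearMap.BilinForm ℝ V) (J : V →ₗ[ℝ] V) (θ : Frame E M V) : Prop :=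
  ∀ (x : M) (X Y : TangentSpace 𝓘(ℝ, E) x), comp02 η J θ (theta η J θ).d x X Y = 0

/-- A connection form: a smooth one-form with values in `Cl²(V)`. -/
def IsConnectionForm (η : LinearMap.BilinForm ℝ V) (A : DForm E M (Cl η) 1) : Prop :=
  A.IsSmooth ∧ ∀ (x : M) (X : TangentSpace 𝓘(ℝ, E) x), A.at₁ x X ∈ clGrade η 2

/-- The covariant derivative `∇_X e = X e + A(X) e - e A(X)` of a section of the trivial bundle
with fibre `V = Cl¹(V)`. -/
def nabla (η : LinearMap.BilinForm ℝ V) (A : DForm E M (Cl η) 1) (e : M → V) (x : M)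
    (X : TangentSpace 𝓘(ℝ, E) x) : V :=
  mvfderiv 𝓘(ℝ, E) e x X
    + proj₁ η (A.at₁ x X * inclR η (e x) - inclR η (e x) * A.at₁ x X)

/-- The connection preserves the metric: `X η(e, f) = η(∇_X e, f) + η(e, ∇_X f)`. -/
def PreservesMetric (η : LinearMap.BilinForm ℝ V) (A : DForm E M (Cl η) 1) : Prop :=
  ∀ e f : M → V, ContMDiff 𝓘(ℝ, E) 𝓘(ℝ, V) ∞ e → ContMDiff 𝓘(ℝ, E) 𝓘(ℝ, V) ∞ f →
    ∀ (x : M) (X : TangentSpace 𝓘(ℝ, E) x),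
      mvfderiv 𝓘(ℝ, E) (fun y => η (e y) (f y)) x X
        = η (nabla η A e x X) (f x) + η (e x) (nabla η A f x X)

/-- The connection preserves the complex structure: `∇_X (J e) = J (∇_X e)`. -/
def PreservesComplexStructure (η : LinearMap.BilinForm ℝ V) (J : V →ₗ[ℝ] V)
    (A : DForm E M (Cl η) 1) : Prop :=
  ∀ e : M → V, ContMDiff 𝓘(ℝ, E) 𝓘(ℝ, V) ∞ e → ∀ (x : M) (X : TangentSpace 𝓘(ℝ, E) x),
    nabla η A (fun y => J (e y)) x X = J (nabla η A e x X)

/-- The torsion `t = dθ + A θ + θ A`. -/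
def torsion (η : LinearMap.BilinForm ℝ V) (θ : Frame E M V) (A : DForm E M (Cl η) 1) :
    DForm E M (Cl η) 2 :=
  (thetaR η θ).d + mulR η A (thetaR η θ) + mulR η (thetaR η θ) A

/-- A torsion-free connection preserving the metric and the complex structure. -/
structure IsTorsionFreeUnitary (η : LinearMap.BilinForm ℝ V) (J : V →ₗ[ℝ] V) (θ : Frame E M V)
    (A : DForm E M (Cl η) 1) : Prop where
  isConnectionForm : IsConnectionForm η A
  preservesMetric : PreservesMetric η A
  preservesComplexStructure : PreservesComplexStructure η J A
  torsion_eq_zero : torsion η θ A = 0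

end Clifford

end CliffordForms

end

open scoped Manifold ContDiff TensorProduct

noncomputable section

namespace CliffordForms

/-! ### Bivectors and skew operators: `Cl²(V)` as the Lie algebra of `η`. -/

section CliffordAlgebra

variable {V : Type*} [AddCommGroup V] [Module ℝ V] (η : LinearMap.BilinForm ℝ V)

/-! Everything reduces to linear algebra at a point. The commutator action on vectors identifies
`Cl²(V)` with the `η`-skew operators on `V` (`adEnd_spin`, `spin_adEnd`), so a connection form
amounts to a map `S : V → End V` at each point, read through the frame, with every `S X` skew. Let
`T` be `dθ^ℝ` read in the frame. Vanishing torsion says `S X Y - S Y X = -T X Y`, and preservation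
of the complex structure says that each `S X` commutes with `J`.

Skew `S` with prescribed antisymmetrization is unique (`metric_torsionFree_unique`) and is given by
the Koszul formula, so the only candidate is the Levi-Civita connection, and the question is whether
it commutes with `J`. The Clifford relations give `w(X, Y) = i η(X, J Y)` in the frame
(`kahlerBilin_eq`), hence `dw = 0` says that the cyclic sum of `η(T X Y, J Z)` vanishes
(`d_kahlerForm_eq_zero_iff`). Integrability becomes the vanishing of the Nijenhuis expression of `T`
(`nijenhuis_dBilin`). These two identities make the Koszul solution commute with `J`
(`koszul_comm`). Conversely, a skew `S` commuting with `J` makes `η(S X Y, J Z)` symmetric in `Y`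
and `Z`, and the cyclic sum cancels (`cyclic_of_comm`).

The analytic point is the smoothness of the Levi-Civita form. The exterior derivative at each point
is computed in that point's own chart, so its independence of the chart is needed
(`Frame.fderiv_inChart`). -/

theorem polar_halfForm (hη : η.IsSymm) (a b : V) : QuadraticMap.polar (halfForm η) a b = η a b := by
  have h := hη.eq b a
  simp only [halfForm, QuadraticMap.polar, smul_apply,
    LinearMap.BilinMap.toQuadraticMap_apply, map_add, LinearMap.add_apply, smul_eq_mul]
  linarith

theorem inclR_mul_add_swap (hη : η.IsSymm) (a b : V) :
    inclR η a * inclR η b + inclR η b * inclR η a = algebraMap ℝ (Cl η) (η a b) := by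
  rw [inclR, CliffordAlgebra.ι_mul_ι_add_swap, polar_halfForm η hη]

theorem proj₁_inclR (v : V) : proj₁ η (inclR η v) = v := by
  have h : CliffordAlgebra.equivExterior (halfForm η) (inclR η v) = ExteriorAlgebra.ι ℝ v :=
    CliffordAlgebra.changeForm_ι CliffordAlgebra.changeForm.associated_neg_proof v
  exact (congrArg ExteriorAlgebra.ιInv h).trans (ExteriorAlgebra.ι_leftInverse v)

/-- The commutator of two vectors in the Clifford algebra. -/
def bivector : V →ₗ[ℝ] V →ₗ[ℝ] Cl η :=
  LinearMap.mk₂ ℝ (fun a b => inclR η a * inclR η b - inclR η b * inclR η a)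
    (fun a b c => by simp only [map_add, add_mul, mul_add]; abel)
    (fun r a b => by simp [smul_sub])
    (fun a b c => by simp only [map_add, add_mul, mul_add]; abel)
    (fun r a b => by simp [smul_sub])

theorem bivector_apply (a b : V) :
    bivector η a b = inclR η a * inclR η b - inclR η b * inclR η a := rfl

theorem bivector_swap (a b : V) : bivector η a b = -bivector η b a := by
  simp [bivector_apply]

/-- The scalars `b v + v b` and `a v + v a` are central. Commuting the first past `a` and the second
past `b` gives two linear relations among the six triple products, and their difference is the
claim. -/
theorem commutator_bivector (hη : η.IsSymm) (a b v : V) :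
    bivector η a b * inclR η v - inclR η v * bivector η a b
      = inclR η ((2 : ℝ) • (η b v • a - η a v • b)) := by
  have hab := inclR_mul_add_swap η hη a b
  have hbv := inclR_mul_add_swap η hη b v
  have hav := inclR_mul_add_swap η hη a v
  rw [bivector_apply]
  simp only [map_add, map_smul, map_sub, two_smul]
  simp only [Algebra.smul_def, ← hav, ← hbv]
  have cb := Algebra.commutes (η b v) (inclR η a)
  have ca := Algebra.commutes (η a v) (inclR η b)
  rw [← hbv] at cb
  rw [← hav] at ca
  have cb' : inclR η b * inclR η v * inclR η a + inclR η v * inclR η b * inclR η a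
      = inclR η a * inclR η b * inclR η v + inclR η a * inclR η v * inclR η b := by
    simpa only [add_mul, mul_add, ← mul_assoc] using cb
  have ca' : inclR η a * inclR η v * inclR η b + inclR η v * inclR η a * inclR η b
      = inclR η b * inclR η a * inclR η v + inclR η b * inclR η v * inclR η a := by
    simpa only [add_mul, mul_add, ← mul_assoc] using ca
  simp only [add_mul, sub_mul, mul_sub, ← mul_assoc]
  generalize inclR η a * inclR η b * inclR η v = x1 at *
  generalize inclR η b * inclR η a * inclR η v = x2 at *
  generalize inclR η v * inclR η a * inclR η b = x3 at *
  generalize inclR η v * inclR η b * inclR η a = x4 at *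
  generalize inclR η a * inclR η v * inclR η b = x5 at *
  generalize inclR η b * inclR η v * inclR η a = x6 at *
  linear_combination (norm := module) ca' - cb'

/-- The canonical isomorphism changes a product of two vectors by a scalar symmetric in them, which
drops out of the commutator. -/
theorem equivExterior_bivector (a b : V) :
    CliffordAlgebra.equivExterior (halfForm η) (bivector η a b)
      = (2 : ℝ) • ExteriorAlgebra.ιMulti ℝ 2 ![a, b] := by
  have h : ∀ a b : V, CliffordAlgebra.equivExterior (halfForm η) (inclR η a * inclR η b)
      = ExteriorAlgebra.ι ℝ a * ExteriorAlgebra.ι ℝ b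
        - algebraMap ℝ _ (QuadraticMap.associated (R := ℝ) (-halfForm η) a b) :=
    fun a b => CliffordAlgebra.changeForm_ι_mul_ι
      CliffordAlgebra.changeForm.associated_neg_proof a b
  have hs : QuadraticMap.associated (R := ℝ) (-halfForm η) a b
      = QuadraticMap.associated (R := ℝ) (-halfForm η) b a :=
    QuadraticMap.associated_isSymm ℝ (-halfForm η) a b
  have hsw := ExteriorAlgebra.ι_add_mul_swap (R := ℝ) a b
  rw [bivector_apply, map_sub, h, h, hs, sub_sub_sub_cancel_right]
  have : ExteriorAlgebra.ιMulti ℝ 2 ![a, b] = ExteriorAlgebra.ι ℝ a * ExteriorAlgebra.ι ℝ b := by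
    simp [ExteriorAlgebra.ιMulti_apply]
  rw [this, two_smul, eq_neg_of_add_eq_zero_right hsw, sub_neg_eq_add]

theorem clGrade_two_eq_span :
    clGrade η 2 = Submodule.span ℝ (Set.range fun p : V × V => bivector η p.1 p.2) := by
  apply le_antisymm
  · intro A hA
    have hA' : CliffordAlgebra.equivExterior (halfForm η) A ∈ ⋀[ℝ]^2 V := hA
    rw [← ExteriorAlgebra.ιMulti_span_fixedDegree] at hA'
    rw [← (CliffordAlgebra.equivExterior (halfForm η)).symm_apply_apply A]
    generalize CliffordAlgebra.equivExterior (halfForm η) A = x at hA'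
    induction hA' using Submodule.span_induction with
    | mem x hx =>
      obtain ⟨m, rfl⟩ := hx
      have hm : m = ![m 0, m 1] := by ext i; fin_cases i <;> rfl
      have h2 := equivExterior_bivector η (m 0) (m 1)
      rw [← hm] at h2
      have : (CliffordAlgebra.equivExterior (halfForm η)).symm (ExteriorAlgebra.ιMulti ℝ 2 m)
          = (1 / 2 : ℝ) • bivector η (m 0) (m 1) := by
        rw [LinearEquiv.symm_apply_eq, map_smul, h2, smul_smul]
        norm_num
      rw [this]
      exact Submodule.smul_mem _ _ (Submodule.subset_span ⟨(m 0, m 1), rfl⟩)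
    | zero => rw [map_zero]; exact Submodule.zero_mem _
    | add x y _ _ hx hy => rw [map_add]; exact Submodule.add_mem _ hx hy
    | smul c x _ hx => rw [map_smul]; exact Submodule.smul_mem _ _ hx
  · rw [Submodule.span_le]
    rintro _ ⟨⟨a, b⟩, rfl⟩
    change CliffordAlgebra.equivExterior (halfForm η) (bivector η a b) ∈ ⋀[ℝ]^2 V
    rw [equivExterior_bivector η, ← ExteriorAlgebra.ιMulti_span_fixedDegree]
    exact Submodule.smul_mem _ _ (Submodule.subset_span ⟨_, rfl⟩)

theorem bivector_mem_clGrade (a b : V) : bivector η a b ∈ clGrade η 2 := by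
  rw [clGrade_two_eq_span η]
  exact Submodule.subset_span ⟨(a, b), rfl⟩

/-- The action `v ↦ A v - v A` of an element `A` of the Clifford algebra on `V`. -/
def adEnd : Cl η →ₗ[ℝ] V →ₗ[ℝ] V :=
  LinearMap.mk₂ ℝ (fun A v => proj₁ η (A * inclR η v - inclR η v * A))
    (fun A B v => by rw [← map_add]; congr 1; simp only [add_mul, mul_add]; abel)
    (fun r A v => by rw [← map_smul]; congr 1; simp [smul_sub])
    (fun A u v => by rw [← map_add]; congr 1; simp only [map_add, add_mul, mul_add]; abel)
    (fun r A v => by rw [← map_smul]; congr 1; simp [smul_sub])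

theorem adEnd_apply (A : Cl η) (v : V) :
    adEnd η A v = proj₁ η (A * inclR η v - inclR η v * A) := rfl

theorem adEnd_bivector (hη : η.IsSymm) (a b v : V) :
    adEnd η (bivector η a b) v = (2 : ℝ) • (η b v • a - η a v • b) := by
  rw [adEnd_apply, commutator_bivector η hη, proj₁_inclR]

/-- The projection in `adEnd` loses nothing on `Cl²(V)`, since commutators of bivectors with vectors
are already vectors. -/
theorem inclR_adEnd (hη : η.IsSymm) {A : Cl η} (hA : A ∈ clGrade η 2) (v : V) :
    inclR η (adEnd η A v) = A * inclR η v - inclR η v * A := by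
  rw [clGrade_two_eq_span η] at hA
  induction hA using Submodule.span_induction with
  | mem x hx =>
    obtain ⟨⟨a, b⟩, rfl⟩ := hx
    simp only
    rw [adEnd_bivector η hη, commutator_bivector η hη]
  | zero => simp
  | add x y _ _ hx hy =>
    rw [map_add, LinearMap.add_apply, map_add, hx, hy, add_mul, mul_add]; abel
  | smul c x _ hx => simp [hx, smul_sub]

theorem adEnd_skew (hη : η.IsSymm) {A : Cl η} (hA : A ∈ clGrade η 2) (u v : V) :
    η (adEnd η A u) v + η u (adEnd η A v) = 0 := by
  rw [clGrade_two_eq_span η] at hA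
  induction hA using Submodule.span_induction with
  | mem x hx =>
    obtain ⟨⟨a, b⟩, rfl⟩ := hx
    have h1 : η u a = η a u := hη.eq u a
    have h2 : η u b = η b u := hη.eq u b
    simp [adEnd_bivector η hη, h1, h2]
    ring
  | zero => simp
  | add x y _ _ hx hy => simp; linarith
  | smul c x _ hx => simp [← mul_add, hx]

variable [FiniteDimensional ℝ V] (hnd : η.Nondegenerate)

/-- The element of `Cl²(V)` whose commutator with vectors is a given skew operator on `V`. -/
def spin : (V →ₗ[ℝ] V) →ₗ[ℝ] Cl η where
  toFun B := (1 / 4 : ℝ) • ∑ i, bivector η (B (Module.finBasis ℝ V i))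
    (η.dualBasis hnd (Module.finBasis ℝ V) i)
  map_add' B C := by simp [Finset.sum_add_distrib]
  map_smul' c B := by simp [← Finset.smul_sum, smul_comm c]

theorem spin_apply (B : V →ₗ[ℝ] V) : spin η hnd B = (1 / 4 : ℝ) • ∑ i,
    bivector η (B (Module.finBasis ℝ V i)) (η.dualBasis hnd (Module.finBasis ℝ V) i) := rfl

theorem spin_mem_clGrade (B : V →ₗ[ℝ] V) : spin η hnd B ∈ clGrade η 2 :=
  Submodule.smul_mem _ _ (Submodule.sum_mem _ fun _ _ => bivector_mem_clGrade η _ _)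

omit [FiniteDimensional ℝ V] in
theorem sum_apply_smul_dualBasis {ι : Type*} [Fintype ι] [DecidableEq ι]
    (b : Module.Basis ι ℝ V) (v : V) :
    ∑ i, η v (b i) • η.dualBasis hnd b i = v := by
  simpa using (η.dualBasis hnd b).sum_repr v

omit [FiniteDimensional ℝ V] in
theorem sum_apply_dualBasis_smul {ι : Type*} [Fintype ι] [DecidableEq ι]
    (b : Module.Basis ι ℝ V) (v : V) : ∑ i, η (η.dualBasis hnd b i) v • b i = v := by
  have h : ∀ i, b.repr v i = η (η.dualBasis hnd b i) v := fun i => by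
    conv_rhs => rw [← b.sum_repr v]
    simp only [map_sum, map_smul, LinearMap.BilinForm.apply_dualBasis_left, smul_eq_mul]
    simp
  conv_rhs => rw [← b.sum_repr v]
  simp [h]

/-- Each bivector acts with a factor `2`, and its two terms each sum to `B v`: one by expanding `v`
in the basis, the other by skewness and expanding `B v` in the dual basis. This accounts for the
constant `1 / 4` in `spin`. -/
theorem adEnd_spin (hη : η.IsSymm) {B : V →ₗ[ℝ] V} (hB : ∀ u v, η (B u) v + η u (B v) = 0) :
    adEnd η (spin η hnd B) = B := by
  ext v
  have h1 := sum_apply_dualBasis_smul η hnd (Module.finBasis ℝ V) v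
  have h2 := sum_apply_smul_dualBasis η hnd (Module.finBasis ℝ V) (B v)
  have h3 : ∀ u, η (B u) v = - η (B v) u := fun u => by
    have := hB u v
    have h4 : η u (B v) = η (B v) u := hη.eq u (B v)
    linarith
  simp only [spin_apply, map_smul, map_sum, LinearMap.smul_apply, LinearMap.sum_apply,
    adEnd_bivector η hη, h3, ← Finset.smul_sum, Finset.sum_sub_distrib, neg_smul,
    Finset.sum_neg_distrib, h2]
  have h5 : ∑ i, η (η.dualBasis hnd (Module.finBasis ℝ V) i) v • B (Module.finBasis ℝ V i)
      = B v := by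
    conv_rhs => rw [← h1]
    simp
  rw [h5]
  module

theorem spin_adEnd (hη : η.IsSymm) {A : Cl η} (hA : A ∈ clGrade η 2) :
    spin η hnd (adEnd η A) = A := by
  rw [clGrade_two_eq_span η] at hA
  induction hA using Submodule.span_induction with
  | mem x hx =>
    obtain ⟨⟨a, b⟩, rfl⟩ := hx
    have ha := sum_apply_smul_dualBasis η hnd (Module.finBasis ℝ V) a
    have hb := sum_apply_smul_dualBasis η hnd (Module.finBasis ℝ V) b
    have key : ∀ c d : V, ∑ i, η d (Module.finBasis ℝ V i) •
        bivector η c (η.dualBasis hnd (Module.finBasis ℝ V) i) = bivector η c d := fun c d => by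
      conv_rhs => rw [← sum_apply_smul_dualBasis η hnd (Module.finBasis ℝ V) d]
      simp
    simp only [spin_apply, adEnd_bivector η hη, map_smul, map_sub, LinearMap.smul_apply,
      LinearMap.sub_apply, ← Finset.smul_sum, Finset.sum_sub_distrib, key]
    rw [bivector_swap η b a]
    module
  | zero => simp
  | add x y _ _ hx hy => simp [hx, hy]
  | smul c x _ hx => simp [hx]

end CliffordAlgebra

/-! ### The Koszul formula and its compatibility with `J`. -/

section Koszul

variable {V : Type*} [AddCommGroup V] [Module ℝ V] [FiniteDimensional ℝ V]
  (η : LinearMap.BilinForm ℝ V) (hnd : η.Nondegenerate) (T : V →ₗ[ℝ] V →ₗ[ℝ] V)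

/-- The `η`-dual of the Koszul expression: the unique metric solution `S` of
`S X Y - S Y X = - T X Y`. -/
def koszul : V →ₗ[ℝ] V →ₗ[ℝ] V :=
  LinearMap.mk₂ ℝ (fun X Y => ∑ i, (-(1 / 2 : ℝ) * (η (T X Y) (Module.finBasis ℝ V i)
      - η (T Y (Module.finBasis ℝ V i)) X + η (T (Module.finBasis ℝ V i) X) Y)) •
        η.dualBasis hnd (Module.finBasis ℝ V) i)
    (fun X X' Y => by
      rw [← Finset.sum_add_distrib]
      refine Finset.sum_congr rfl fun i _ => ?_
      rw [← add_smul]; congr 1; simp; ring)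
    (fun r X Y => by
      rw [Finset.smul_sum]
      refine Finset.sum_congr rfl fun i _ => ?_
      rw [smul_smul]; congr 1; simp; ring)
    (fun X Y Y' => by
      rw [← Finset.sum_add_distrib]
      refine Finset.sum_congr rfl fun i _ => ?_
      rw [← add_smul]; congr 1; simp; ring)
    (fun r X Y => by
      rw [Finset.smul_sum]
      refine Finset.sum_congr rfl fun i _ => ?_
      rw [smul_smul]; congr 1; simp; ring)

theorem koszul_apply (X Y : V) : koszul η hnd T X Y =
    ∑ i, (-(1 / 2 : ℝ) * (η (T X Y) (Module.finBasis ℝ V i)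
      - η (T Y (Module.finBasis ℝ V i)) X + η (T (Module.finBasis ℝ V i) X) Y)) •
        η.dualBasis hnd (Module.finBasis ℝ V) i := rfl

theorem apply_koszul (X Y Z : V) : η (koszul η hnd T X Y) Z
    = -(1 / 2 : ℝ) * (η (T X Y) Z - η (T Y Z) X + η (T Z X) Y) := by
  have h : η (koszul η hnd T X Y) = -(1 / 2 : ℝ) • (η (T X Y)
      - (η.flip X) ∘ₗ (T Y) + (η.flip Y) ∘ₗ (T.flip X)) := by
    refine (Module.finBasis ℝ V).ext fun j => ?_
    simp [koszul_apply, LinearMap.BilinForm.apply_dualBasis_left]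
    ring
  rw [h]
  simp
  ring

theorem koszul_skew (hη : η.IsSymm) (hT : ∀ X Y, T X Y = -T Y X) (X Y Z : V) :
    η (koszul η hnd T X Y) Z + η Y (koszul η hnd T X Z) = 0 := by
  have h : η Y (koszul η hnd T X Z) = η (koszul η hnd T X Z) Y := (hη.eq _ _).symm
  rw [h, apply_koszul, apply_koszul, hT X Y, hT Z Y, hT X Z]
  simp
  ring

omit [FiniteDimensional ℝ V] in
include hnd in
theorem eq_of_forall_apply_eq {u v : V} (h : ∀ z, η u z = η v z) : u = v := by
  have := hnd.1 (u - v) (fun z => by simp [h z])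
  exact sub_eq_zero.1 this

theorem koszul_sub_swap (hT : ∀ X Y, T X Y = -T Y X) (X Y : V) :
    koszul η hnd T X Y - koszul η hnd T Y X = -T X Y := by
  refine eq_of_forall_apply_eq η hnd fun Z => ?_
  rw [map_sub, LinearMap.sub_apply, apply_koszul, apply_koszul, hT Y X, hT Z Y, hT X Z]
  simp
  ring

variable {J : V →ₗ[ℝ] V} (hJ : ∀ v, J (J v) = -v) (hJη : ∀ v u, η (J v) (J u) = η v u)
include hJ hJη

omit [FiniteDimensional ℝ V] in
theorem apply_J_left (u v : V) : η (J u) v = -η u (J v) := by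
  have := hJη u (J v)
  rw [hJ] at this
  simp at this
  linarith

/-- This is the pointwise form of the classical formula expressing `∇J` through `dw` and the
Nijenhuis tensor. -/
theorem koszul_comm
    (hN : ∀ X Y, T X Y - T (J X) (J Y) + J (T (J X) Y + T X (J Y)) = 0)
    (hc : ∀ X Y Z, η (T X Y) (J Z) + η (T Y Z) (J X) + η (T Z X) (J Y) = 0) (X Y : V) :
    koszul η hnd T X (J Y) = J (koszul η hnd T X Y) := by
  refine eq_of_forall_apply_eq η hnd fun Z => ?_
  rw [apply_J_left η hJ hJη, apply_koszul, apply_koszul]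
  -- The goal is a multiple of `c1 - c2 - n`: the terms `η(T Y Z, J X)` and `η(T (J Y) (J Z), J X)`
  -- cancel, leaving the six Koszul terms.
  have c1 := hc X Y Z
  have c2 := hc X (J Y) (J Z)
  have n := congrArg (fun v => η v (J X)) (hN Y Z)
  simp only [map_add, map_sub, LinearMap.add_apply, LinearMap.sub_apply, hJη, hJ, map_neg,
    LinearMap.zero_apply, map_zero] at c1 c2 n ⊢
  linarith

omit [FiniteDimensional ℝ V] in
theorem cyclic_of_comm (hη : η.IsSymm) {S : V →ₗ[ℝ] V →ₗ[ℝ] V}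
    (hskew : ∀ X Y Z, η (S X Y) Z + η Y (S X Z) = 0) (hS : ∀ X Y, S X Y - S Y X = -T X Y)
    (hcomm : ∀ X Y, S X (J Y) = J (S X Y)) (X Y Z : V) :
    η (T X Y) (J Z) + η (T Y Z) (J X) + η (T Z X) (J Y) = 0 := by
  have h : ∀ X Y, T X Y = S Y X - S X Y := fun X Y => by
    have := hS X Y
    rw [← neg_eq_iff_eq_neg] at this
    rw [← this, neg_sub]
  -- The product of two commuting skew operators, `J` and `S X`, is symmetric.
  have key : ∀ X Y Z, η (S X Y) (J Z) = η (S X Z) (J Y) := fun X Y Z => by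
    have h1 := hskew X Y (J Z)
    rw [hcomm] at h1
    have h2 := apply_J_left η hJ hJη Y (S X Z)
    have h3 : η (S X Z) (J Y) = η (J Y) (S X Z) := hη.eq _ _
    linarith
  simp only [h, map_sub, LinearMap.sub_apply]
  rw [key X Y Z, key Y X Z, key Z X Y]
  ring

omit [FiniteDimensional ℝ V] hJ hJη in
include hnd in
-- For `D = S - S'`, the trilinear form `η(D X Y, Z)` is symmetric in `X, Y` and antisymmetric in
-- `Y, Z`; such a form vanishes.
theorem metric_torsionFree_unique (hη : η.IsSymm) {S S' : V →ₗ[ℝ] V →ₗ[ℝ] V}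
    (hskew : ∀ X Y Z, η (S X Y) Z + η Y (S X Z) = 0)
    (hskew' : ∀ X Y Z, η (S' X Y) Z + η Y (S' X Z) = 0)
    (h : ∀ X Y, S X Y - S Y X = S' X Y - S' Y X) : S = S' := by
  ext X Y
  refine eq_of_forall_apply_eq η hnd fun Z => ?_
  have sy : ∀ u v, η u v = η v u := fun u v => hη.eq u v
  have e : ∀ X Y Z, η (S X Y) Z - η (S Y X) Z = η (S' X Y) Z - η (S' Y X) Z := fun X Y Z => by
    have := congrArg (fun v => η v Z) (h X Y)
    simpa using this
  have a : ∀ X Y Z, η (S X Y) Z = - η (S X Z) Y := fun X Y Z => by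
    have := hskew X Y Z; rw [sy Y] at this; linarith
  have a' : ∀ X Y Z, η (S' X Y) Z = - η (S' X Z) Y := fun X Y Z => by
    have := hskew' X Y Z; rw [sy Y] at this; linarith
  linarith [e X Y Z, e Y Z X, e Z X Y, a X Y Z, a Y Z X, a Z X Y, a' X Y Z, a' Y Z X, a' Z X Y]

end Koszul

/-! ### The complexified Clifford algebra and the values of `w`. -/

section Complexification

variable {V : Type*} [AddCommGroup V] [Module ℝ V] (η : LinearMap.BilinForm ℝ V) (J : V →ₗ[ℝ] V)

theorem polar_baseChange (hη : η.IsSymm) (z w : ℂ) (u v : V) :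
    QuadraticMap.polar ((halfForm η).baseChange ℂ) (z ⊗ₜ u) (w ⊗ₜ v) = z * w * (η u v : ℂ) := by
  have h : QuadraticMap.polarBilin ((halfForm η).baseChange ℂ) (z ⊗ₜ u) (w ⊗ₜ v)
      = z * w * (η u v : ℂ) := by
    rw [QuadraticForm.polarBilin_baseChange, LinearMap.BilinForm.baseChange_tmul,
      QuadraticMap.polarBilin_apply_apply, polar_halfForm η hη]
    simp [Algebra.smul_def, mul_comm]
  exact h

theorem holPart_apply (v : V) :
    holPart J v = ((1 / 2 : ℂ) ⊗ₜ[ℝ] v - (Complex.I / 2) ⊗ₜ[ℝ] J v : ℂ ⊗[ℝ] V) := rfl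

theorem antiholPart_apply (v : V) :
    antiholPart J v = ((1 / 2 : ℂ) ⊗ₜ[ℝ] v + (Complex.I / 2) ⊗ₜ[ℝ] J v : ℂ ⊗[ℝ] V) := rfl

theorem polar_holPart_antiholPart (hη : η.IsSymm) (hJ : ∀ v, J (J v) = -v)
    (hJη : ∀ v u, η (J v) (J u) = η v u) (u v : V) :
    QuadraticMap.polar ((halfForm η).baseChange ℂ) (holPart J u) (antiholPart J v)
      = (1 / 2 : ℂ) * (η u v + Complex.I * η u (J v)) := by
  rw [← QuadraticMap.polarBilin_apply_apply, holPart_apply, antiholPart_apply]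
  simp only [map_add, map_sub, LinearMap.sub_apply, QuadraticMap.polarBilin_apply_apply,
    polar_baseChange η hη, hJη, apply_J_left η hJ hJη u v, Complex.ofReal_neg]
  ring_nf
  rw [Complex.I_sq]
  ring

/-- This turns complex coefficients into `J`, and so the complex integrability condition into a real
one. -/
theorem I_smul_holPart (hJ : ∀ v, J (J v) = -v) (v : V) :
    Complex.I • holPart J v = holPart J (J v) := by
  rw [holPart_apply, holPart_apply, hJ, smul_sub, TensorProduct.smul_tmul',
    TensorProduct.smul_tmul', TensorProduct.tmul_neg, smul_eq_mul, smul_eq_mul,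
    show Complex.I * (Complex.I / 2) = -(1 / 2) by rw [← mul_div_assoc, Complex.I_mul_I]; ring,
    TensorProduct.neg_tmul, mul_one_div]
  abel

theorem holPart_injective : Function.Injective (holPart J) := by
  rw [injective_iff_map_eq_zero]
  intro v hv
  -- The real part of `holPart J v` is `v / 2`.
  have h := congrArg ((TensorProduct.lid ℝ V).toLinearMap ∘ₗ LinearMap.rTensor V Complex.reLm) hv
  rw [holPart_apply] at h
  simp at h
  exact h

theorem inclC_injective : Function.Injective (inclC η) := by
  intro u v h
  have h2 : ∀ w, CliffordAlgebra.equivExterior ((halfForm η).baseChange ℂ) (inclC η w)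
      = ExteriorAlgebra.ι ℂ w := fun w =>
    CliffordAlgebra.changeForm_ι CliffordAlgebra.changeForm.associated_neg_proof w
  have := congrArg (CliffordAlgebra.equivExterior ((halfForm η).baseChange ℂ)) h
  rw [h2, h2] at this
  exact ExteriorAlgebra.ι_leftInverse.injective this

theorem inclC_smul (z : ℂ) (w : ℂ ⊗[ℝ] V) : inclC η (z • w) = z • inclC η w :=
  (CliffordAlgebra.ι ((halfForm η).baseChange ℂ)).map_smul z w

instance instNontrivialClC : Nontrivial (ClC η) :=
  (CliffordAlgebra.equivExterior ((halfForm η).baseChange ℂ)).toEquiv.nontrivial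

/-- The multiples of the imaginary unit in the Clifford algebra. -/
def imaginary : ℝ →ₗ[ℝ] ClC η :=
  LinearMap.toSpanSingleton ℝ (ClC η) (algebraMap ℂ (ClC η) Complex.I)

theorem imaginary_injective : Function.Injective (imaginary η) := by
  intro r s h
  have e : ∀ r : ℝ, imaginary η r = algebraMap ℂ (ClC η) (r * Complex.I) := fun r => by
    rw [imaginary, LinearMap.toSpanSingleton_apply, Algebra.algebraMap_eq_smul_one,
        Algebra.algebraMap_eq_smul_one, ← smul_assoc, Complex.real_smul]
  rw [e, e] at h
  simpa using (algebraMap ℂ (ClC η)).injective h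

/-- The values of the Kähler form on a pair of vectors of `V`. -/
def kahlerBilin : V →ₗ[ℝ] V →ₗ[ℝ] ClC η := (η.compl₂ J).compr₂ (imaginary η)

theorem kahlerBilin_apply (u v : V) : kahlerBilin η J u v = imaginary η (η u (J v)) := rfl

/-- The four products regroup into two anticommutators, which are scalars by the Clifford relations.
Their `η u v` parts cancel by symmetry, and their `J` parts add up since `η u (J v)` is
antisymmetric. -/
theorem kahlerBilin_eq (hη : η.IsSymm) (hJ : ∀ v, J (J v) = -v)
    (hJη : ∀ v u, η (J v) (J u) = η v u) (u v : V) :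
    inclC η (holPart J u) * inclC η (antiholPart J v)
      - inclC η (holPart J v) * inclC η (antiholPart J u)
      - (inclC η (antiholPart J u) * inclC η (holPart J v)
        - inclC η (antiholPart J v) * inclC η (holPart J u)) = kahlerBilin η J u v := by
  have h : ∀ u v, inclC η (holPart J u) * inclC η (antiholPart J v)
      + inclC η (antiholPart J v) * inclC η (holPart J u)
      = algebraMap ℂ (ClC η) ((1 / 2 : ℂ) * (η u v + Complex.I * η u (J v))) := fun u v => by
    rw [← polar_holPart_antiholPart η J hη hJ hJη]
    exact CliffordAlgebra.ι_mul_ι_add_swap _ _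
  have e : η v u = η u v := hη.eq v u
  have e' : η v (J u) = - η u (J v) := by
    rw [← apply_J_left η hJ hJη]; exact hη.eq _ _
  calc _ = (inclC η (holPart J u) * inclC η (antiholPart J v)
      + inclC η (antiholPart J v) * inclC η (holPart J u))
      - (inclC η (holPart J v) * inclC η (antiholPart J u)
      + inclC η (antiholPart J u) * inclC η (holPart J v)) := by abel
    _ = _ := by
      rw [h, h, ← map_sub, e, e', kahlerBilin_apply, imaginary,
        LinearMap.toSpanSingleton_apply, Algebra.algebraMap_eq_smul_one,
        Algebra.algebraMap_eq_smul_one, ← smul_assoc, Complex.real_smul]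
      congr 1
      push_cast
      ring

end Complexification

/-! ### Frames in charts and independence of `dθ` from the chart. -/

section Forms

variable {E : Type*} [NormedAddCommGroup E] [NormedSpace ℝ E]
  {F : Type*} [NormedAddCommGroup F] [NormedSpace ℝ F]

theorem extDeriv_ofSubsingleton {a : E → E →L[ℝ] F} {y : E} (ha : DifferentiableAt ℝ a y)
    (X Y : E) :
    extDeriv (fun z => ContinuousAlternatingMap.ofSubsingleton ℝ E F (0 : Fin 1) (a z)) y ![X, Y]
      = fderiv ℝ a y X Y - fderiv ℝ a y Y X := by
  have hd : DifferentiableAt ℝ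
      (fun z => ContinuousAlternatingMap.ofSubsingleton ℝ E F (0 : Fin 1) (a z)) y :=
    (ContinuousAlternatingMap.ofSubsingletonLIE (𝕜 := ℝ) (E := E) (F := F)
      (0 : Fin 1)).differentiableAt.comp y ha
  rw [extDeriv_apply hd]
  have h : ∀ v : Fin 1 → E, fderiv ℝ
      (fun z => ContinuousAlternatingMap.ofSubsingleton ℝ E F (0 : Fin 1) (a z) v) y
      = (fderiv ℝ a y).flip (v 0) := fun v => by
    ext w
    simp only [ContinuousAlternatingMap.ofSubsingleton_apply_apply]
    rw [fderiv_clm_apply ha (by fun_prop)]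
    simp
  simp only [h]
  simp [Fin.removeNth]
  abel

variable {M : Type*} [TopologicalSpace M] [ChartedSpace E M]
  {V : Type*} [NormedAddCommGroup V] [NormedSpace ℝ V] [FiniteDimensional ℝ V]

/-- The derivative of the preferred chart at `x₀`, as an operator on the model space. -/
def chartDeriv (x₀ q : M) : E →L[ℝ] E := mfderiv 𝓘(ℝ, E) 𝓘(ℝ, E) (extChartAt 𝓘(ℝ, E) x₀) q

/-- The derivative of the inverse of the preferred chart at `x₀`, as an operator on the model
space. -/
def chartSymmDeriv (x₀ : M) (y : E) : E →L[ℝ] E :=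
  mfderiv 𝓘(ℝ, E) 𝓘(ℝ, E) (extChartAt 𝓘(ℝ, E) x₀).symm y

/-- The frame at a point, as a linear map on the model space. -/
def Frame.toModel (θ : Frame E M V) (x : M) : E →L[ℝ] V :=
  (θ x : TangentSpace 𝓘(ℝ, E) x →L[ℝ] V)

/-- A frame read in the preferred chart at `x₀`. -/
def Frame.inChart (θ : Frame E M V) (x₀ : M) (y : E) : E →L[ℝ] V :=
  θ.toModel ((extChartAt 𝓘(ℝ, E) x₀).symm y) ∘L chartSymmDeriv x₀ y

theorem Frame.form_inChart (θ : Frame E M V) (L : V →ₗ[ℝ] F) (x₀ : M) :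
    (θ.form L).inChart x₀ = fun y => ContinuousAlternatingMap.ofSubsingleton ℝ E F (0 : Fin 1)
      (L.toContinuousLinearMap ∘L θ.inChart x₀ y) := by
  rfl

/-- The exterior derivative of a frame, regarded as a `V`-valued one-form. -/
def Frame.dV (θ : Frame E M V) (x : M) (X Y : E) : V :=
  fderiv ℝ (θ.inChart x) (extChartAt 𝓘(ℝ, E) x x) X Y
    - fderiv ℝ (θ.inChart x) (extChartAt 𝓘(ℝ, E) x x) Y X

theorem Frame.contDiffOn_inChart [FiniteDimensional ℝ E] {η : LinearMap.BilinForm ℝ V}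
    {θ : Frame E M V} (h : (thetaR η θ).IsSmooth) (x₀ : M) :
    ContDiffOn ℝ ∞ (θ.inChart x₀) (extChartAt 𝓘(ℝ, E) x₀).target := by
  rw [contDiffOn_clm_apply]
  intro v
  have h1 := h x₀
  have h2 := ((proj₁ η).toContinuousLinearMap ∘L
    ContinuousAlternatingMap.apply ℝ E (Cl η) (fun _ : Fin 1 => v)).contDiff.comp_contDiffOn h1
  refine h2.congr fun y _ => ?_
  exact (proj₁_inclR η (θ.inChart x₀ y v)).symm

theorem Frame.differentiableAt_inChart [FiniteDimensional ℝ E] {η : LinearMap.BilinForm ℝ V}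
    {θ : Frame E M V} (h : (thetaR η θ).IsSmooth) (x₀ : M) {y : E}
    (hy : y ∈ (extChartAt 𝓘(ℝ, E) x₀).target) : DifferentiableAt ℝ (θ.inChart x₀) y :=
  ((θ.contDiffOn_inChart h x₀).contDiffAt
    ((isOpen_extChartAt_target x₀).mem_nhds hy)).differentiableAt (by simp)

variable [IsManifold 𝓘(ℝ, E) ∞ M]

theorem DForm.d_apply {k : ℕ} (α : DForm E M F k) (x : M)
    (v : Fin (k + 1) → TangentSpace 𝓘(ℝ, E) x) :
    α.d x v = extDeriv (α.inChart x) (extChartAt 𝓘(ℝ, E) x x) v := by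
  have : IsManifold 𝓘(ℝ, E) 1 M := .of_le (n := ∞) (by simp)
  -- The tangent space at `x` is modelled on `E` through the preferred chart at `x`, whose
  -- derivative there is therefore the identity.
  have h : chartDeriv x x = ContinuousLinearMap.id ℝ E := mfderiv_extChartAt_self
  exact congrArg (fun L : E →L[ℝ] E =>
    extDeriv (α.inChart x) (extChartAt 𝓘(ℝ, E) x x) (L ∘ v)) h

theorem Frame.d_form [FiniteDimensional ℝ E] {η : LinearMap.BilinForm ℝ V}
    {θ : Frame E M V} (h : (thetaR η θ).IsSmooth) (L : V →ₗ[ℝ] F) (x : M)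
    (X Y : TangentSpace 𝓘(ℝ, E) x) : (θ.form L).d x ![X, Y] = L (θ.dV x X Y) := by
  have hd := θ.differentiableAt_inChart h x (mem_extChartAt_target (I := 𝓘(ℝ, E)) x)
  rw [DForm.d_apply, form_inChart]
  refine (extDeriv_ofSubsingleton (DifferentiableAt.clm_comp (by fun_prop) hd) X Y).trans ?_
  have e : fderiv ℝ (fun y => L.toContinuousLinearMap ∘L θ.inChart x y) (extChartAt 𝓘(ℝ, E) x x)
      = (ContinuousLinearMap.compL ℝ E V F L.toContinuousLinearMap) ∘L
        fderiv ℝ (θ.inChart x) (extChartAt 𝓘(ℝ, E) x x) :=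
    ((ContinuousLinearMap.compL ℝ E V F L.toContinuousLinearMap).hasFDerivAt.comp _
      hd.hasFDerivAt).fderiv
  rw [e]
  exact (map_sub L _ _).symm

theorem chartSymmDeriv_comp_chartDeriv {x₀ q : M} (hq : q ∈ (extChartAt 𝓘(ℝ, E) x₀).source) :
    chartSymmDeriv x₀ (extChartAt 𝓘(ℝ, E) x₀ q) ∘L chartDeriv x₀ q = .id ℝ E := by
  have : IsManifold 𝓘(ℝ, E) 1 M := .of_le (n := ∞) (by simp)
  have h := mfderivWithin_extChartAt_symm_comp_mfderiv_extChartAt' hq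
  rwa [ModelWithCorners.range_eq_univ, mfderivWithin_univ] at h

theorem chartDeriv_comp_chartSymmDeriv {x₀ : M} {y : E}
    (hy : y ∈ (extChartAt 𝓘(ℝ, E) x₀).target) :
    chartDeriv x₀ ((extChartAt 𝓘(ℝ, E) x₀).symm y) ∘L chartSymmDeriv x₀ y = .id ℝ E := by
  have : IsManifold 𝓘(ℝ, E) 1 M := .of_le (n := ∞) (by simp)
  have h := mfderiv_extChartAt_comp_mfderivWithin_extChartAt_symm hy
  rwa [ModelWithCorners.range_eq_univ, mfderivWithin_univ] at h

theorem chartSymmDeriv_self (p : M) : chartSymmDeriv p (extChartAt 𝓘(ℝ, E) p p) = .id ℝ E := by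
  have : IsManifold 𝓘(ℝ, E) 1 M := .of_le (n := ∞) (by simp)
  have h := mfderivWithin_range_extChartAt_symm (I := 𝓘(ℝ, E)) (x := p)
  rwa [ModelWithCorners.range_eq_univ, mfderivWithin_univ] at h

theorem fderiv_coordChange {x₀ p : M} {y : E} (hy : y ∈ (extChartAt 𝓘(ℝ, E) p).target)
    (hq : (extChartAt 𝓘(ℝ, E) p).symm y ∈ (extChartAt 𝓘(ℝ, E) x₀).source) :
    fderiv ℝ (extChartAt 𝓘(ℝ, E) x₀ ∘ (extChartAt 𝓘(ℝ, E) p).symm) y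
      = chartDeriv x₀ ((extChartAt 𝓘(ℝ, E) p).symm y) ∘L chartSymmDeriv p y := by
  have : IsManifold 𝓘(ℝ, E) 1 M := .of_le (n := ∞) (by simp)
  have h1 : MDifferentiableAt 𝓘(ℝ, E) 𝓘(ℝ, E) (extChartAt 𝓘(ℝ, E) p).symm y := by
    have := mdifferentiableWithinAt_extChartAt_symm hy
    rwa [ModelWithCorners.range_eq_univ, mdifferentiableWithinAt_univ] at this
  have h2 : MDifferentiableAt 𝓘(ℝ, E) 𝓘(ℝ, E) (extChartAt 𝓘(ℝ, E) x₀)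
      ((extChartAt 𝓘(ℝ, E) p).symm y) :=
    mdifferentiableAt_extChartAt (by rwa [extChartAt_source] at hq)
  rw [← mfderiv_eq_fderiv]
  exact mfderiv_comp y h2 h1

omit [FiniteDimensional ℝ V] in
theorem Frame.inChart_comp_chartDeriv (θ : Frame E M V) {x₀ q : M}
    (hq : q ∈ (extChartAt 𝓘(ℝ, E) x₀).source) :
    θ.inChart x₀ (extChartAt 𝓘(ℝ, E) x₀ q) ∘L chartDeriv x₀ q = θ.toModel q := by
  rw [inChart, (extChartAt 𝓘(ℝ, E) x₀).left_inv hq, ContinuousLinearMap.comp_assoc,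
    chartSymmDeriv_comp_chartDeriv hq, ContinuousLinearMap.comp_id]

omit [FiniteDimensional ℝ V] in
theorem Frame.inChart_self (θ : Frame E M V) (x : M) :
    θ.inChart x (extChartAt 𝓘(ℝ, E) x x) = θ.toModel x := by
  rw [inChart, extChartAt_to_inv, chartSymmDeriv_self, ContinuousLinearMap.comp_id]

/-- Near `p`, the frame in the chart at `p` is the pull-back by the transition map `τ` of the frame
in the chart at `x₀`, and `extDeriv` commutes with pull-backs. This lets `dV p` be computed in one
fixed chart as `p` varies, as smoothness requires. -/
theorem Frame.fderiv_inChart [FiniteDimensional ℝ E] {η : LinearMap.BilinForm ℝ V}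
    {θ : Frame E M V} (h : (thetaR η θ).IsSmooth) {x₀ p : M}
    (hp : p ∈ (extChartAt 𝓘(ℝ, E) x₀).source) (X Y : E) :
    fderiv ℝ (θ.inChart x₀) (extChartAt 𝓘(ℝ, E) x₀ p) (chartDeriv x₀ p X) (chartDeriv x₀ p Y)
      - fderiv ℝ (θ.inChart x₀) (extChartAt 𝓘(ℝ, E) x₀ p) (chartDeriv x₀ p Y)
        (chartDeriv x₀ p X) = θ.dV p X Y := by
  set τ : E → E := extChartAt 𝓘(ℝ, E) x₀ ∘ (extChartAt 𝓘(ℝ, E) p).symm with hτ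
  set y := extChartAt 𝓘(ℝ, E) p p with hy
  have hpy : (extChartAt 𝓘(ℝ, E) p).symm y = p := extChartAt_to_inv p
  have hτy : τ y = extChartAt 𝓘(ℝ, E) x₀ p := congrArg (extChartAt 𝓘(ℝ, E) x₀) hpy
  have hev : θ.inChart p =ᶠ[nhds y] fun z => θ.inChart x₀ (τ z) ∘L fderiv ℝ τ z := by
    have h1 : (extChartAt 𝓘(ℝ, E) p).target ∈ nhds y := extChartAt_target_mem_nhds p
    have h2 : (extChartAt 𝓘(ℝ, E) p).symm ⁻¹' (extChartAt 𝓘(ℝ, E) x₀).source ∈ nhds y :=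
      (continuousAt_extChartAt_symm p).preimage_mem_nhds
        (by rw [hpy]; exact extChartAt_source_mem_nhds' hp)
    filter_upwards [h1, h2] with z hz1 hz2
    rw [fderiv_coordChange hz1 hz2, ← ContinuousLinearMap.comp_assoc]
    exact congrArg (· ∘L chartSymmDeriv p z) (θ.inChart_comp_chartDeriv hz2).symm
  have hτs : ContDiffAt ℝ ∞ τ y := by
    have := contDiffWithinAt_ext_coord_change (I := 𝓘(ℝ, E)) (n := ∞) x₀ p (y := y) (by
      rw [PartialEquiv.trans_source]
      refine ⟨mem_extChartAt_target p, ?_⟩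
      rwa [Set.mem_preimage, hpy])
    rwa [ModelWithCorners.range_eq_univ, contDiffWithinAt_univ] at this
  have hτd : fderiv ℝ τ y = chartDeriv x₀ p := by
    rw [fderiv_coordChange (mem_extChartAt_target p) (by rwa [hpy]), chartSymmDeriv_self, hpy,
      ContinuousLinearMap.comp_id]
  have hdx : DifferentiableAt ℝ (θ.inChart x₀) (τ y) := by
    rw [hτy]
    exact θ.differentiableAt_inChart h x₀ ((extChartAt 𝓘(ℝ, E) x₀).map_source hp)
  have hd := θ.differentiableAt_inChart h p (mem_extChartAt_target (I := 𝓘(ℝ, E)) p)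
  have hω : DifferentiableAt ℝ (fun z => ContinuousAlternatingMap.ofSubsingleton ℝ E V (0 : Fin 1)
      (θ.inChart x₀ z)) (τ y) :=
    (ContinuousAlternatingMap.ofSubsingletonLIE (𝕜 := ℝ) (E := E) (F := V)
      (0 : Fin 1)).differentiableAt.comp (τ y) hdx
  have hpull := extDeriv_pullback hω hτs (by
    rw [minSmoothness_of_isRCLikeNormedField]
    exact WithTop.coe_le_coe.2 (le_top : (2 : ℕ∞) ≤ ⊤))
  have hL : extDeriv (fun z => ContinuousAlternatingMap.ofSubsingleton ℝ E V (0 : Fin 1)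
      (θ.inChart p z)) y ![X, Y] = θ.dV p X Y := extDeriv_ofSubsingleton hd X Y
  have hev' := Filter.EventuallyEq.extDeriv_eq (hev.fun_comp
    (ContinuousAlternatingMap.ofSubsingleton ℝ E V (0 : Fin 1)))
  have hR := congrArg (fun L => L ![X, Y]) (hev'.trans hpull)
  refine Eq.trans ?_ (hR.symm.trans hL)
  rw [← hτd, ← hτy]
  refine (extDeriv_ofSubsingleton hdx _ _).symm.trans ?_
  change _ = extDeriv _ _ (fderiv ℝ τ y ∘ ![X, Y])
  congr 1
  ext i; fin_cases i <;> rfl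

end Forms

/-! ### The derivative of `w` and the integrability condition in the frame. -/

section Kahler

variable {E : Type*} [NormedAddCommGroup E] [NormedSpace ℝ E] [FiniteDimensional ℝ E]
  {M : Type*} [TopologicalSpace M] [ChartedSpace E M]
  {V : Type*} [NormedAddCommGroup V] [NormedSpace ℝ V] [FiniteDimensional ℝ V]
  {η : LinearMap.BilinForm ℝ V} {J : V →ₗ[ℝ] V} {θ : Frame E M V}

omit [FiniteDimensional ℝ E] in
theorem kahlerForm_apply (hη : η.IsSymm) (hJ : ∀ v, J (J v) = -v)
    (hJη : ∀ v u, η (J v) (J u) = η v u) (x : M) (X Y : TangentSpace 𝓘(ℝ, E) x) :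
    kahlerForm η J θ x ![X, Y] = kahlerBilin η J (θ x X) (θ x Y) := by
  rw [← kahlerBilin_eq η J hη hJ hJη]
  change mulC η (theta η J θ) (thetaBar η J θ) x ![X, Y]
    - mulC η (thetaBar η J θ) (theta η J θ) x ![X, Y] = _
  rw [mulC, mulC, DForm.wedge₁_apply, DForm.wedge₁_apply]
  rfl

variable [IsManifold 𝓘(ℝ, E) ∞ M]

omit [FiniteDimensional ℝ E] [IsManifold 𝓘(ℝ, E) ∞ M] in
theorem kahlerForm_inChart (hη : η.IsSymm) (hJ : ∀ v, J (J v) = -v)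
    (hJη : ∀ v u, η (J v) (J u) = η v u) (x : M) (y : E) (v : Fin 2 → E) :
    (kahlerForm η J θ).inChart x y v
      = kahlerBilin η J (θ.inChart x y (v 0)) (θ.inChart x y (v 1)) := by
  refine Eq.trans ?_ (kahlerForm_apply hη hJ hJη ((extChartAt 𝓘(ℝ, E) x).symm y)
    (chartSymmDeriv x y (v 0)) (chartSymmDeriv x y (v 1)))
  change kahlerForm η J θ ((extChartAt 𝓘(ℝ, E) x).symm y) (fun i => chartSymmDeriv x y (v i)) = _
  congr 1
  ext i; fin_cases i <;> rfl

omit [IsManifold 𝓘(ℝ, E) ∞ M] in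
theorem differentiableAt_kahlerForm_inChart (hη : η.IsSymm) (hJ : ∀ v, J (J v) = -v)
    (hJη : ∀ v u, η (J v) (J u) = η v u) (h : (thetaR η θ).IsSmooth) (x : M) :
    DifferentiableAt ℝ ((kahlerForm η J θ).inChart x) (extChartAt 𝓘(ℝ, E) x x) := by
  have hd := θ.differentiableAt_inChart h x (mem_extChartAt_target (I := 𝓘(ℝ, E)) x)
  -- In the frame, `w` has constant coefficients: it is the pull-back by `θ` of one alternating form
  -- `K` on `V`. Transporting `w` at the single point `x` to `V` yields `K`.
  obtain ⟨K, hK⟩ : ∃ K : V [⋀^Fin 2]→L[ℝ] ClC η,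
      ∀ u : Fin 2 → V, K u = kahlerBilin η J (u 0) (u 1) := by
    refine ⟨(kahlerForm η J θ x).compContinuousLinearMap
      ((θ x).symm : V →L[ℝ] TangentSpace 𝓘(ℝ, E) x), fun u => ?_⟩
    have := kahlerForm_apply (θ := θ) hη hJ hJη x ((θ x).symm (u 0)) ((θ x).symm (u 1))
    rw [ContinuousLinearEquiv.apply_symm_apply, ContinuousLinearEquiv.apply_symm_apply] at this
    refine Eq.trans ?_ this
    change kahlerForm η J θ x (fun i => (θ x).symm (u i)) = _
    congr 1
    ext i; fin_cases i <;> rfl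
  have e : (kahlerForm η J θ).inChart x = fun y => K.compContinuousLinearMap (θ.inChart x y) := by
    funext y
    ext v
    rw [kahlerForm_inChart hη hJ hJη]
    rw [ContinuousAlternatingMap.compContinuousLinearMap_apply, hK]
    rfl
  rw [e]
  exact DifferentiableAt.continuousAlternatingMapCompContinuousLinearMap
    (differentiableAt_const K) hd

theorem fderiv_kahlerForm_inChart (hη : η.IsSymm) (hJ : ∀ v, J (J v) = -v)
    (hJη : ∀ v u, η (J v) (J u) = η v u) (h : (thetaR η θ).IsSmooth) (x : M) (v : Fin 2 → E)
    (Z : E) :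
    fderiv ℝ (fun y => (kahlerForm η J θ).inChart x y v) (extChartAt 𝓘(ℝ, E) x x) Z
      = kahlerBilin η J (θ.toModel x (v 0))
          (fderiv ℝ (θ.inChart x) (extChartAt 𝓘(ℝ, E) x x) Z (v 1))
        + kahlerBilin η J (fderiv ℝ (θ.inChart x) (extChartAt 𝓘(ℝ, E) x x) Z (v 0))
          (θ.toModel x (v 1)) := by
  have hd := θ.differentiableAt_inChart h x (mem_extChartAt_target (I := 𝓘(ℝ, E)) x)
  have ha : ∀ w : E, HasFDerivAt (fun y => θ.inChart x y w)
      ((fderiv ℝ (θ.inChart x) (extChartAt 𝓘(ℝ, E) x x)).flip w) (extChartAt 𝓘(ℝ, E) x x) :=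
    fun w => by simpa using hd.hasFDerivAt.clm_apply (hasFDerivAt_const w _)
  have hB := (kahlerBilin η J).toContinuousBilinearMap.hasFDerivAt_of_bilinear (ha (v 0)) (ha (v 1))
  have e : (fun y => (kahlerForm η J θ).inChart x y v) = fun y =>
      (kahlerBilin η J).toContinuousBilinearMap (θ.inChart x y (v 0)) (θ.inChart x y (v 1)) := by
    funext y
    exact kahlerForm_inChart hη hJ hJη x y v
  rw [e, hB.fderiv, ← θ.inChart_self]
  rfl

omit [FiniteDimensional ℝ V] in
theorem kahlerBilin_swap (hη : η.IsSymm) (hJ : ∀ v, J (J v) = -v)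
    (hJη : ∀ v u, η (J v) (J u) = η v u) (u v : V) :
    kahlerBilin η J u v = -kahlerBilin η J v u := by
  have e : η u (J v) = - η v (J u) := by
    rw [← apply_J_left η hJ hJη]; exact hη.eq _ _
  rw [kahlerBilin_apply, kahlerBilin_apply, e, map_neg]

/-- Since `w` is constant in the frame, only `θ` gets differentiated; antisymmetry of `kahlerBilin`
pairs the six resulting terms into three values of `dθ`. -/
theorem d_kahlerForm_apply (hη : η.IsSymm) (hJ : ∀ v, J (J v) = -v)
    (hJη : ∀ v u, η (J v) (J u) = η v u) (h : (thetaR η θ).IsSmooth) (x : M)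
    (X Y Z : E) :
    (kahlerForm η J θ).d x ![X, Y, Z]
      = imaginary η (η (θ.dV x X Y) (J (θ.toModel x Z)) + η (θ.dV x Y Z) (J (θ.toModel x X))
        + η (θ.dV x Z X) (J (θ.toModel x Y))) := by
  have e : (kahlerForm η J θ).d x ![X, Y, Z]
      = extDeriv ((kahlerForm η J θ).inChart x) (extChartAt 𝓘(ℝ, E) x x) ![X, Y, Z] :=
    DForm.d_apply _ x _
  rw [e, extDeriv_apply (differentiableAt_kahlerForm_inChart hη hJ hJη h x)]
  simp only [fderiv_kahlerForm_inChart hη hJ hJη h]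
  rw [Fin.sum_univ_three]
  rw [map_add, map_add, ← kahlerBilin_apply, ← kahlerBilin_apply, ← kahlerBilin_apply]
  simp only [Frame.dV, map_sub, LinearMap.sub_apply]
  generalize fderiv ℝ (θ.inChart x) (extChartAt 𝓘(ℝ, E) x x) = D
  have k := fun u v => kahlerBilin_swap hη hJ hJη u v
  have e2 : ![X, Y, Z] (Fin.succAbove 2 1) = Y := rfl
  simp only [Fin.removeNth_apply, e2]
  simp
  rw [k _ (D X Z), k _ (D Y Z), k _ (D Z _)]
  abel

/-- The `(0, 2)` component of `dθ` is a quarter of the image of this vector under the injective map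
`inclC η ∘ₗ holPart J`, once each factor `i` has been replaced by `J`. -/
theorem nijenhuis_eq_zero (hJ : ∀ v, J (J v) = -v) (h : (thetaR η θ).IsSmooth)
    (hint : IsIntegrable η J θ) (x : M) (X Y : TangentSpace 𝓘(ℝ, E) x) :
    θ.dV x X Y - θ.dV x (θ.tangentJ J x X) (θ.tangentJ J x Y)
      + J (θ.dV x (θ.tangentJ J x X) Y + θ.dV x X (θ.tangentJ J x Y)) = 0 := by
  apply holPart_injective J
  apply inclC_injective η
  have h1 := hint x X Y
  rw [comp02, theta, θ.d_form h, θ.d_form h, θ.d_form h, θ.d_form h,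
    smul_eq_zero_iff_right (by norm_num)] at h1
  simp only [LinearMap.comp_apply, ← inclC_smul, I_smul_holPart J hJ, ← map_add, ← map_sub] at h1
  rw [map_zero, map_zero, ← h1]
  congr 2
  rw [map_add]
  abel

end Kahler

/-! ### Derivatives of `V`-valued functions on `M`. -/

section Derivatives

variable {E : Type*} [NormedAddCommGroup E] [NormedSpace ℝ E]
  {M : Type*} [TopologicalSpace M] [ChartedSpace E M]
  {V : Type*} [NormedAddCommGroup V] [NormedSpace ℝ V]

theorem hasFDerivAt_mvfderiv {e : M → V} (he : ContMDiff 𝓘(ℝ, E) 𝓘(ℝ, V) ∞ e) (x : M) :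
    HasFDerivAt (e ∘ (extChartAt 𝓘(ℝ, E) x).symm) (mvfderiv 𝓘(ℝ, E) e x : E →L[ℝ] V)
      (extChartAt 𝓘(ℝ, E) x x) := by
  have h := ((he x).mdifferentiableAt (by simp)).hasMFDerivAt.2
  rw [ModelWithCorners.range_eq_univ] at h
  exact HasFDerivWithinAt.hasFDerivAt (E := E) (F := V) h Filter.univ_mem

theorem mvfderiv_eq_of_hasFDerivAt {e : M → V} {x : M} {e' : E →L[ℝ] V} (hc : ContinuousAt e x)
    (he : HasFDerivAt (e ∘ (extChartAt 𝓘(ℝ, E) x).symm) e' (extChartAt 𝓘(ℝ, E) x x))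
    (X : E) : mvfderiv 𝓘(ℝ, E) e x X = e' X := by
  have h : HasMFDerivAt 𝓘(ℝ, E) 𝓘(ℝ, V) e x e' := by
    refine ⟨hc, ?_⟩
    exact HasFDerivAt.hasFDerivWithinAt (E := E) (F := V) he
  exact congrArg (fun L : E →L[ℝ] V => L X) h.mfderiv

theorem mvfderiv_linear [FiniteDimensional ℝ V] (J : V →ₗ[ℝ] V) {e : M → V}
    (he : ContMDiff 𝓘(ℝ, E) 𝓘(ℝ, V) ∞ e) (x : M) (X : E) :
    mvfderiv 𝓘(ℝ, E) (fun y => J (e y)) x X = J (mvfderiv 𝓘(ℝ, E) e x X) :=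
  mvfderiv_eq_of_hasFDerivAt
    (J.toContinuousLinearMap.continuous.continuousAt.comp he.continuous.continuousAt)
    (J.toContinuousLinearMap.hasFDerivAt.comp _ (hasFDerivAt_mvfderiv he x)) X

theorem mvfderiv_bilin [FiniteDimensional ℝ V] (η : LinearMap.BilinForm ℝ V) {e f : M → V}
    (he : ContMDiff 𝓘(ℝ, E) 𝓘(ℝ, V) ∞ e) (hf : ContMDiff 𝓘(ℝ, E) 𝓘(ℝ, V) ∞ f)
    (x : M) (X : E) :
    mvfderiv 𝓘(ℝ, E) (fun y => η (e y) (f y)) x X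
      = η (mvfderiv 𝓘(ℝ, E) e x X) (f x) + η (e x) (mvfderiv 𝓘(ℝ, E) f x X) := by
  have h := η.toContinuousBilinearMap.hasFDerivAt_of_bilinear (hasFDerivAt_mvfderiv he x)
    (hasFDerivAt_mvfderiv hf x)
  have hc : ContinuousAt (fun y => η (e y) (f y)) x :=
    (η.toContinuousBilinearMap.continuous.comp he.continuous).continuousAt.clm_apply
      hf.continuous.continuousAt
  rw [mvfderiv_eq_of_hasFDerivAt hc h X, add_comm (η _ _)]
  have he' : e ((extChartAt 𝓘(ℝ, E) x).symm (extChartAt 𝓘(ℝ, E) x x)) = e x := by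
    rw [extChartAt_to_inv]
  have hf' : f ((extChartAt 𝓘(ℝ, E) x).symm (extChartAt 𝓘(ℝ, E) x x)) = f x := by
    rw [extChartAt_to_inv]
  rw [← he', ← hf']
  rfl

end Derivatives

/-! ### Connections in the frame: pointwise form of the conditions. -/

section Connection

variable {E : Type*} [NormedAddCommGroup E] [NormedSpace ℝ E]
  {M : Type*} [TopologicalSpace M] [ChartedSpace E M]
  {V : Type*} [NormedAddCommGroup V] [NormedSpace ℝ V]

/-- A one-form at a point, as a linear map on the model space. -/
def DForm.toLinear {F : Type*} [NormedAddCommGroup F] [NormedSpace ℝ F] (α : DForm E M F 1)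
    (x : M) : E →ₗ[ℝ] F where
  toFun X := α.at₁ x X
  map_add' X Y := by
    have h : ∀ Z : E, α.at₁ x Z
        = (ContinuousAlternatingMap.ofSubsingleton ℝ E F (0 : Fin 1)).symm (α x) Z := fun Z =>
      congrArg (α x) (by ext i; fin_cases i; rfl)
    rw [h, h, h, map_add]
  map_smul' c X := by
    have h : ∀ Z : E, α.at₁ x Z
        = (ContinuousAlternatingMap.ofSubsingleton ℝ E F (0 : Fin 1)).symm (α x) Z := fun Z =>
      congrArg (α x) (by ext i; fin_cases i; rfl)
    rw [h, h, map_smul, RingHom.id_apply]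

theorem DForm.ext_at₁ {F : Type*} [NormedAddCommGroup F] [NormedSpace ℝ F] {α β : DForm E M F 1}
    (h : ∀ (x : M) (X : E), α.at₁ x X = β.at₁ x X) : α = β := by
  funext x
  refine ContinuousAlternatingMap.ext fun v => ?_
  have hv : v = ![v 0] := by ext i; fin_cases i; rfl
  rw [hv]
  exact h x (v 0)

/-- The inverse of a frame at a point, with values in the model space. -/
def Frame.invModel (θ : Frame E M V) (x : M) : V →L[ℝ] E :=
  ((θ x).symm : V →L[ℝ] TangentSpace 𝓘(ℝ, E) x)

theorem Frame.toModel_invModel (θ : Frame E M V) (x : M) (v : V) :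
    θ.toModel x (θ.invModel x v) = v := (θ x).apply_symm_apply v

theorem Frame.invModel_toModel (θ : Frame E M V) (x : M) (X : E) :
    θ.invModel x (θ.toModel x X) = X := (θ x).symm_apply_apply X

variable [FiniteDimensional ℝ V]

/-- The exterior derivative of a frame at a point, as a bilinear map on `V`. -/
def Frame.dBilin (θ : Frame E M V) (x : M) : V →ₗ[ℝ] V →ₗ[ℝ] V :=
  LinearMap.mk₂ ℝ (fun u v => θ.dV x (θ.invModel x u) (θ.invModel x v))
    (fun u u' v => by simp only [Frame.dV, map_add, add_apply]; abel)
    (fun c u v => by simp only [Frame.dV, map_smul, smul_apply, smul_sub])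
    (fun u v v' => by simp only [Frame.dV, map_add, add_apply]; abel)
    (fun c u v => by simp only [Frame.dV, map_smul, smul_apply, smul_sub])

omit [FiniteDimensional ℝ V] in
theorem Frame.dBilin_apply (θ : Frame E M V) (x : M) (u v : V) :
    θ.dBilin x u v = θ.dV x (θ.invModel x u) (θ.invModel x v) := rfl

omit [FiniteDimensional ℝ V] in
theorem Frame.dBilin_toModel (θ : Frame E M V) (x : M) (X Y : E) :
    θ.dBilin x (θ.toModel x X) (θ.toModel x Y) = θ.dV x X Y := by
  rw [dBilin_apply, invModel_toModel, invModel_toModel]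

omit [FiniteDimensional ℝ V] in
theorem Frame.dBilin_swap (θ : Frame E M V) (x : M) (u v : V) :
    θ.dBilin x u v = -θ.dBilin x v u := by
  rw [dBilin_apply, dBilin_apply, dV, dV, neg_sub]

variable (η : LinearMap.BilinForm ℝ V) (J : V →ₗ[ℝ] V) (θ : Frame E M V)

/-- The action of a connection form on `V`, at a point and in terms of the frame. -/
def connectionBilin (A : DForm E M (Cl η) 1) (x : M) : V →ₗ[ℝ] V →ₗ[ℝ] V :=
  adEnd η ∘ₗ A.toLinear x ∘ₗ (θ.invModel x).toLinearMap

theorem connectionBilin_toModel (A : DForm E M (Cl η) 1) (x : M) (X : E) :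
    connectionBilin η θ A x (θ.toModel x X) = adEnd η (A.at₁ x X) :=
  congrArg (fun Y : E => adEnd η (A.at₁ x Y)) (θ.invModel_toModel x X)

theorem nabla_eq (A : DForm E M (Cl η) 1) (e : M → V) (x : M) (X : E) :
    nabla η A e x X = mvfderiv 𝓘(ℝ, E) e x X + adEnd η (A.at₁ x X) (e x) := rfl

variable {η θ J}

theorem preservesMetric_of_isConnectionForm (hη : η.IsSymm) {A : DForm E M (Cl η) 1}
    (hA : ∀ (x : M) (X : E), A.at₁ x X ∈ clGrade η 2) : PreservesMetric η A := by
  intro e f he hf x (X : E)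
  have h := adEnd_skew η hη (hA x X) (e x) (f x)
  rw [nabla_eq, nabla_eq, map_add, LinearMap.add_apply, map_add]
  refine (mvfderiv_bilin η he hf x X).trans ?_
  linear_combination -h

/-- Constant sections have zero derivative and take every value, so they detect the algebraic part
of `∇`; the derivative part always commutes with the constant operator `J`. -/
theorem preservesComplexStructure_iff {A : DForm E M (Cl η) 1} :
    PreservesComplexStructure η J A
      ↔ ∀ (x : M) (u v : V), connectionBilin η θ A x u (J v) = J (connectionBilin η θ A x u v) := by
  constructor
  · intro h x u v
    have h1 := h (fun _ => v) contMDiff_const x (θ.invModel x u)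
    rw [nabla_eq, nabla_eq, mvfderiv_const, mvfderiv_const] at h1
    have z : (0 : TangentSpace 𝓘(ℝ, E) x →L[ℝ] V) (θ.invModel x u) = 0 := rfl
    rw [z, zero_add, zero_add] at h1
    exact h1
  · intro h e he x (X : E)
    rw [nabla_eq, nabla_eq, map_add]
    have h1 := h x (θ.toModel x X) (e x)
    rw [connectionBilin_toModel] at h1
    rw [h1]
    congr 1
    exact mvfderiv_linear J he x X

variable [FiniteDimensional ℝ E] [IsManifold 𝓘(ℝ, E) ∞ M]

/-- The wedge sign turns the anticommutator `A θ + θ A` of one-forms into commutators of their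
values, which is the action `adEnd`. -/
theorem torsion_apply (hη : η.IsSymm) (h : (thetaR η θ).IsSmooth) {A : DForm E M (Cl η) 1}
    (hA : ∀ (x : M) (X : E), A.at₁ x X ∈ clGrade η 2) (x : M) (X Y : E) :
    torsion η θ A x ![X, Y] = inclR η (θ.dV x X Y + adEnd η (A.at₁ x X) (θ.toModel x Y)
      - adEnd η (A.at₁ x Y) (θ.toModel x X)) := by
  have h1 : (thetaR η θ).d x ![X, Y] = inclR η (θ.dV x X Y) := θ.d_form h _ x X Y
  have h2 : torsion η θ A x ![X, Y] = (thetaR η θ).d x ![X, Y]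
      + (mulR η A (thetaR η θ) x ![X, Y] + mulR η (thetaR η θ) A x ![X, Y]) := add_assoc _ _ _
  have h3 : mulR η A (thetaR η θ) x ![X, Y] = A.at₁ x X * inclR η (θ.toModel x Y)
      - A.at₁ x Y * inclR η (θ.toModel x X) := DForm.wedge₁_apply _ _ _ x X Y
  have h4 : mulR η (thetaR η θ) A x ![X, Y] = inclR η (θ.toModel x X) * A.at₁ x Y
      - inclR η (θ.toModel x Y) * A.at₁ x X := DForm.wedge₁_apply _ _ _ x X Y
  rw [h2, h1, h3, h4, map_sub, map_add, inclR_adEnd η hη (hA x X), inclR_adEnd η hη (hA x Y)]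
  abel

theorem torsion_eq_zero_iff (hη : η.IsSymm) (h : (thetaR η θ).IsSmooth) {A : DForm E M (Cl η) 1}
    (hA : ∀ (x : M) (X : E), A.at₁ x X ∈ clGrade η 2) :
    torsion η θ A = 0 ↔ ∀ (x : M) (u v : V),
      connectionBilin η θ A x u v - connectionBilin η θ A x v u = -θ.dBilin x u v := by
  have hinj : ∀ w : V, inclR η w = 0 ↔ w = 0 := fun w =>
    ⟨fun h0 => by rw [← proj₁_inclR η w, h0, map_zero], fun h0 => by rw [h0, map_zero]⟩
  constructor
  · intro h0 x u v
    have h1 := torsion_apply hη h hA x (θ.invModel x u) (θ.invModel x v)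
    rw [h0] at h1
    have h2 := (hinj _).1 h1.symm
    rw [← connectionBilin_toModel η θ, ← connectionBilin_toModel η θ, θ.toModel_invModel,
      θ.toModel_invModel, ← θ.dBilin_apply] at h2
    rw [eq_neg_iff_add_eq_zero, ← h2]
    abel
  · intro h0
    funext x
    refine ContinuousAlternatingMap.ext fun (v : Fin 2 → E) => ?_
    have hv : v = ![v 0, v 1] := by ext i; fin_cases i <;> rfl
    rw [hv]
    refine (torsion_apply hη h hA x (v 0) (v 1)).trans ?_
    refine (hinj _).2 ?_
    have h1 := h0 x (θ.toModel x (v 0)) (θ.toModel x (v 1))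
    rw [connectionBilin_toModel, connectionBilin_toModel, θ.dBilin_toModel,
      eq_neg_iff_add_eq_zero] at h1
    rw [← h1]
    abel

theorem d_kahlerForm_eq_zero_iff (hη : η.IsSymm) (hJ : ∀ v, J (J v) = -v)
    (hJη : ∀ v u, η (J v) (J u) = η v u) (h : (thetaR η θ).IsSmooth) :
    (kahlerForm η J θ).d = 0 ↔ ∀ (x : M) (u v w : V), η (θ.dBilin x u v) (J w)
      + η (θ.dBilin x v w) (J u) + η (θ.dBilin x w u) (J v) = 0 := by
  constructor
  · intro h0 x u v w
    have h1 := d_kahlerForm_apply hη hJ hJη h x (θ.invModel x u) (θ.invModel x v) (θ.invModel x w)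
    rw [h0] at h1
    have h2 := imaginary_injective η (h1.symm.trans (map_zero (imaginary η)).symm)
    rwa [θ.toModel_invModel, θ.toModel_invModel, θ.toModel_invModel] at h2
  · intro h0
    funext x
    refine ContinuousAlternatingMap.ext fun (v : Fin 3 → E) => ?_
    have hv : v = ![v 0, v 1, v 2] := by ext i; fin_cases i <;> rfl
    rw [hv]
    refine (d_kahlerForm_apply hη hJ hJη h x (v 0) (v 1) (v 2)).trans ?_
    rw [← θ.dBilin_toModel, ← θ.dBilin_toModel, ← θ.dBilin_toModel, h0, map_zero]
    rfl

theorem nijenhuis_dBilin (hJ : ∀ v, J (J v) = -v) (h : (thetaR η θ).IsSmooth)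
    (hint : IsIntegrable η J θ) (x : M) (u v : V) :
    θ.dBilin x u v - θ.dBilin x (J u) (J v)
      + J (θ.dBilin x (J u) v + θ.dBilin x u (J v)) = 0 := by
  have hJ' : ∀ w : V, θ.tangentJ J x (θ.invModel x w) = θ.invModel x (J w) := fun w =>
    congrArg (fun z => θ.invModel x (J z)) (θ.toModel_invModel x w)
  have h1 := nijenhuis_eq_zero hJ h hint x (θ.invModel x u) (θ.invModel x v)
  rw [hJ', hJ'] at h1
  exact h1

/-! ### The Levi-Civita connection: smoothness, uniqueness and the Kähler condition. -/

variable (η θ) in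
/-- The Levi-Civita connection of a frame. -/
def leviCivita (hnd : η.Nondegenerate) : DForm E M (Cl η) 1 :=
  DForm.ofLinear fun x =>
    (spin η hnd ∘ₗ koszul η hnd (θ.dBilin x)).toContinuousLinearMap ∘L
      (θ x : TangentSpace 𝓘(ℝ, E) x →L[ℝ] V)

omit [FiniteDimensional ℝ E] [IsManifold 𝓘(ℝ, E) ∞ M] in
theorem leviCivita_at₁ (hnd : η.Nondegenerate) (x : M) (X : E) :
    (leviCivita η θ hnd).at₁ x X = spin η hnd (koszul η hnd (θ.dBilin x) (θ.toModel x X)) := rfl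

omit [FiniteDimensional ℝ E] [IsManifold 𝓘(ℝ, E) ∞ M] in
theorem connectionBilin_leviCivita (hη : η.IsSymm) (hnd : η.Nondegenerate) (x : M) :
    connectionBilin η θ (leviCivita η θ hnd) x = koszul η hnd (θ.dBilin x) := by
  ext1 u
  have e := connectionBilin_toModel η θ (leviCivita η θ hnd) x (θ.invModel x u)
  rw [θ.toModel_invModel, leviCivita_at₁, θ.toModel_invModel] at e
  rw [e]
  exact adEnd_spin η hnd hη (koszul_skew η hnd _ hη (θ.dBilin_swap x) u)

/-- In the chart this is the inverse of the invertible smooth family `θ.inChart x₀`, and operator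
inversion is smooth at isomorphisms. -/
theorem Frame.contDiffOn_inverse_inChart (h : (thetaR η θ).IsSmooth) (x₀ : M) :
    ContDiffOn ℝ ∞ (fun y => chartDeriv x₀ ((extChartAt 𝓘(ℝ, E) x₀).symm y) ∘L
      θ.invModel ((extChartAt 𝓘(ℝ, E) x₀).symm y)) (extChartAt 𝓘(ℝ, E) x₀).target := by
  have hl : ∀ y ∈ (extChartAt 𝓘(ℝ, E) x₀).target, Function.LeftInverse
      (chartDeriv x₀ ((extChartAt 𝓘(ℝ, E) x₀).symm y) ∘L
        θ.invModel ((extChartAt 𝓘(ℝ, E) x₀).symm y)) (θ.inChart x₀ y) := fun y hy X => by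
    have := congrArg (fun L => L X) (chartDeriv_comp_chartSymmDeriv hy)
    simpa [Frame.inChart, θ.invModel_toModel] using this
  have hr : ∀ y ∈ (extChartAt 𝓘(ℝ, E) x₀).target, Function.RightInverse
      (chartDeriv x₀ ((extChartAt 𝓘(ℝ, E) x₀).symm y) ∘L
        θ.invModel ((extChartAt 𝓘(ℝ, E) x₀).symm y)) (θ.inChart x₀ y) := fun y hy v => by
    have := congrArg (fun L => L (θ.invModel ((extChartAt 𝓘(ℝ, E) x₀).symm y) v))
      (chartSymmDeriv_comp_chartDeriv ((extChartAt 𝓘(ℝ, E) x₀).map_target hy))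
    rw [(extChartAt 𝓘(ℝ, E) x₀).right_inv hy] at this
    have h2 := congrArg (θ.toModel ((extChartAt 𝓘(ℝ, E) x₀).symm y)) this
    simpa [Frame.inChart, θ.toModel_invModel] using h2
  intro y hy
  let e : E ≃L[ℝ] V := ContinuousLinearEquiv.equivOfInverse _ _ (hl y hy) (hr y hy)
  have h1 : ContDiffAt ℝ ∞ ContinuousLinearMap.inverse (θ.inChart x₀ y) :=
    contDiffAt_map_inverse (n := ∞) e
  refine (h1.comp_contDiffWithinAt y (θ.contDiffOn_inChart h x₀ y hy)).congr_of_mem ?_ hy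
  intro z hz
  refine (ContinuousLinearMap.inverse_eq ?_ ?_).symm
  · ext v; exact hr z hz v
  · ext v; exact hl z hz v

theorem Frame.contDiffOn_dBilin (h : (thetaR η θ).IsSmooth) (x₀ : M) {u v : E → V}
    (hu : ContDiffOn ℝ ∞ u (extChartAt 𝓘(ℝ, E) x₀).target)
    (hv : ContDiffOn ℝ ∞ v (extChartAt 𝓘(ℝ, E) x₀).target) :
    ContDiffOn ℝ ∞ (fun y => θ.dBilin ((extChartAt 𝓘(ℝ, E) x₀).symm y) (u y) (v y))
      (extChartAt 𝓘(ℝ, E) x₀).target := by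
  have hb := θ.contDiffOn_inverse_inChart h x₀
  have hD : ContDiffOn ℝ ∞ (fderiv ℝ (θ.inChart x₀)) (extChartAt 𝓘(ℝ, E) x₀).target :=
    (θ.contDiffOn_inChart h x₀).fderiv_of_isOpen (isOpen_extChartAt_target x₀) (by simp)
  have hbu := hb.clm_apply hu
  have hbv := hb.clm_apply hv
  refine (((hD.clm_apply hbu).clm_apply hbv).sub ((hD.clm_apply hbv).clm_apply hbu)).congr ?_
  intro y hy
  have h1 := θ.fderiv_inChart h ((extChartAt 𝓘(ℝ, E) x₀).map_target hy)
    (θ.invModel ((extChartAt 𝓘(ℝ, E) x₀).symm y) (u y))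
    (θ.invModel ((extChartAt 𝓘(ℝ, E) x₀).symm y) (v y))
  rw [(extChartAt 𝓘(ℝ, E) x₀).right_inv hy] at h1
  exact h1.symm

/-- The Koszul and spin formulas are finite sums over fixed bases of `V`, so smoothness follows from
that of `θ` and of `dBilin` on smooth arguments. -/
theorem leviCivita_isSmooth (hnd : η.Nondegenerate) (h : (thetaR η θ).IsSmooth) :
    (leviCivita η θ hnd).IsSmooth := by
  intro x₀
  set s := (extChartAt 𝓘(ℝ, E) x₀).target
  have hη : ∀ {u v : E → V}, ContDiffOn ℝ ∞ u s → ContDiffOn ℝ ∞ v s →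
      ContDiffOn ℝ ∞ (fun y => η (u y) (v y)) s := fun hu hv =>
    (η.toContinuousBilinearMap.contDiff.comp_contDiffOn hu).clm_apply hv
  have key : ContDiffOn ℝ ∞ (fun y => (spin η hnd ∘ₗ koszul η hnd
      (θ.dBilin ((extChartAt 𝓘(ℝ, E) x₀).symm y))).toContinuousLinearMap ∘L θ.inChart x₀ y) s := by
    rw [contDiffOn_clm_apply]
    intro X
    have ha : ContDiffOn ℝ ∞ (fun y => θ.inChart x₀ y X) s :=
      (θ.contDiffOn_inChart h x₀).clm_apply contDiffOn_const
    have hc : ∀ w : V, ContDiffOn ℝ ∞ (fun _ : E => w) s := fun w => contDiffOn_const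
    have hS : ∀ w : V, ContDiffOn ℝ ∞ (fun y => koszul η hnd
        (θ.dBilin ((extChartAt 𝓘(ℝ, E) x₀).symm y)) (θ.inChart x₀ y X) w) s := fun w => by
      simp only [koszul_apply]
      refine ContDiffOn.sum fun i _ => (contDiffOn_const.mul ?_).smul contDiffOn_const
      exact ((hη (θ.contDiffOn_dBilin h x₀ ha (hc w)) (hc _)).sub
        (hη (θ.contDiffOn_dBilin h x₀ (hc w) (hc _)) ha)).add
        (hη (θ.contDiffOn_dBilin h x₀ (hc _) ha) (hc w))
    simp only [ContinuousLinearMap.comp_apply, LinearMap.coe_toContinuousLinearMap',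
      LinearMap.comp_apply, spin_apply]
    refine ContDiffOn.const_smul (1 / 4 : ℝ) (ContDiffOn.sum fun i _ => ?_)
    have hB : ContDiff ℝ ∞ ((bivector η).flip
        (η.dualBasis hnd (Module.finBasis ℝ V) i)).toContinuousLinearMap :=
      ContinuousLinearMap.contDiff _
    exact hB.comp_contDiffOn (hS _)
  have hL : ContDiff ℝ ∞ (fun L : E →L[ℝ] Cl η =>
      ContinuousAlternatingMap.ofSubsingleton ℝ E (Cl η) (0 : Fin 1) L) :=
    (ContinuousAlternatingMap.ofSubsingletonLIE (𝕜 := ℝ) (E := E) (F := Cl η)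
      (0 : Fin 1)).toContinuousLinearEquiv.contDiff
  exact hL.comp_contDiffOn key

theorem IsTorsionFreeUnitary.eq_leviCivita (hη : η.IsSymm) (hnd : η.Nondegenerate)
    (h : (thetaR η θ).IsSmooth) {A : DForm E M (Cl η) 1} (hA : IsTorsionFreeUnitary η J θ A) :
    A = leviCivita η θ hnd := by
  have hA2 := hA.isConnectionForm.2
  have ht := (torsion_eq_zero_iff hη h hA2).1 hA.torsion_eq_zero
  refine DForm.ext_at₁ fun x X => ?_
  have e : connectionBilin η θ A x = koszul η hnd (θ.dBilin x) :=
    metric_torsionFree_unique η hnd hη (fun u v w => adEnd_skew η hη (hA2 x _) v w)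
      (koszul_skew η hnd _ hη (θ.dBilin_swap x)) fun u v => by
        rw [ht, koszul_sub_swap η hnd _ (θ.dBilin_swap x)]
  rw [leviCivita_at₁, ← e, connectionBilin_toModel, spin_adEnd η hnd hη (hA2 x X)]

theorem IsTorsionFreeUnitary.d_kahlerForm_eq_zero (hη : η.IsSymm) (hJ : ∀ v, J (J v) = -v)
    (hJη : ∀ v u, η (J v) (J u) = η v u) (h : (thetaR η θ).IsSmooth) {A : DForm E M (Cl η) 1}
    (hA : IsTorsionFreeUnitary η J θ A) : (kahlerForm η J θ).d = 0 := by
  have hA2 := hA.isConnectionForm.2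
  have ht := (torsion_eq_zero_iff hη h hA2).1 hA.torsion_eq_zero
  rw [d_kahlerForm_eq_zero_iff hη hJ hJη h]
  exact fun x => cyclic_of_comm η _ hJ hJη hη (fun u v w => adEnd_skew η hη (hA2 x _) v w) (ht x)
    (preservesComplexStructure_iff.1 hA.preservesComplexStructure x)

theorem isTorsionFreeUnitary_leviCivita (hη : η.IsSymm) (hnd : η.Nondegenerate)
    (hJ : ∀ v, J (J v) = -v) (hJη : ∀ v u, η (J v) (J u) = η v u)
    (h : (thetaR η θ).IsSmooth) (hint : IsIntegrable η J θ) (hd : (kahlerForm η J θ).d = 0) :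
    IsTorsionFreeUnitary η J θ (leviCivita η θ hnd) := by
  have hA2 : ∀ (x : M) (X : E), (leviCivita η θ hnd).at₁ x X ∈ clGrade η 2 := fun x X =>
    spin_mem_clGrade η hnd _
  rw [d_kahlerForm_eq_zero_iff hη hJ hJη h] at hd
  refine ⟨⟨leviCivita_isSmooth hnd h, hA2⟩, preservesMetric_of_isConnectionForm hη hA2,
    (preservesComplexStructure_iff (θ := θ)).2 fun x u v => ?_,
    (torsion_eq_zero_iff hη h hA2).2 fun x u v => ?_⟩
  · rw [connectionBilin_leviCivita hη hnd]
    exact koszul_comm η hnd _ hJ hJη (nijenhuis_dBilin hJ h hint x) (hd x) u v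
  · rw [connectionBilin_leviCivita hη hnd]
    exact koszul_sub_swap η hnd _ (θ.dBilin_swap x) u v

end Connection

end CliffordForms

end

open CliffordForms in
theorem proposition5
    {E : Type*} [NormedAddCommGroup E] [NormedSpace ℝ E] [FiniteDimensional ℝ E]
    {M : Type*} [TopologicalSpace M] [ChartedSpace E M] [IsManifold 𝓘(ℝ, E) ∞ M]
    {V : Type*} [NormedAddCommGroup V] [NormedSpace ℝ V] [FiniteDimensional ℝ V]
    (η : LinearMap.BilinForm ℝ V) (hη_symm : η.IsSymm) (hη_nondeg : η.Nondegenerate)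
    (J : V →ₗ[ℝ] V) (hJ : ∀ v, J (J v) = -v) (hJη : ∀ v u, η (J v) (J u) = η v u)
    (θ : Frame E M V) (hθ_smooth : (thetaR η θ).IsSmooth) (hθ_int : IsIntegrable η J θ) :
    ((∃ A : DForm E M (Cl η) 1, IsTorsionFreeUnitary η J θ A) ↔ (kahlerForm η J θ).d = 0) ∧
      ((kahlerForm η J θ).d = 0 →
        ∃! A : DForm E M (Cl η) 1, IsTorsionFreeUnitary η J θ A) := by
  have key := isTorsionFreeUnitary_leviCivita hη_symm hη_nondeg hJ hJη hθ_smooth hθ_int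
  exact ⟨⟨fun ⟨_, hA⟩ => hA.d_kahlerForm_eq_zero hη_symm hJ hJη hθ_smooth, fun hd => ⟨_, key hd⟩⟩,
    fun hd => ⟨_, key hd, fun _ hA => hA.eq_leviCivita hη_symm hη_nondeg hθ_smooth⟩⟩
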